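/- Let $\alpha\ge\omega$ be an ordinal. Algebras of the similarity type of $\mathsf{QEA}_\alpha$ have Boolean operations, cylindrifications $\mathsf c_i$, diagonal constants $\mathsf d_{ij}$, replacements $\mathsf s_{[i/j]}$ and transpositions $\mathsf s_{[i,j]}$ ($i,j<\alpha$); those of the type of $\mathsf{CA}_\alpha$ have only the Boolean operations, the $\mathsf c_i$ and the $\mathsf d_{ij}$, and $\mathfrak{Rd}_{ca}$ denotes the corresponding reduct. $\mathsf{QEA}_\alpha$ is the class of quasi-polyadic equality algebras of dimension $\alpha$ (in the Sain–Thompson axiomatization). $\mathsf{RCA}_\alpha$ (resp. $\mathsf{RQEA}_\alpha$) is the class of algebras of the type of $\mathsf{CA}_\alpha$ (resp. $\mathsf{QEA}_\alpha$) that are isomorphic to a subalgebra of the algebra of all subsets of some $V=\bigcup_{k}{}^{\alpha}U_k$, with the $U_k$ nonempty and pairwise disjoint, where the non-Boolean operations are $\mathsf c_iX=\{s\in V: \exists t\in X\ \forall j\ne i\ \ t_j=s_j\}$, $\mathsf d_{ij}=\{s\in V:s_i=s_j\}$ and $\mathsf s_\tau X=\{s\in V:s\circ\tau\in X\}$ for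 $\tau=[i/j]$ (the map sending $i$ to $j$ and fixing everything else) and $\tau=[i,j]$ (the transposition). For an equation $e$ in the language of $\mathsf{QEA}_\omega$, its $\alpha$-instances are the equations $\eta^+(e)$ obtained by replacing each dimension index $i<\omega$ by $\eta(i)$, where $\eta:\omega\to\alpha$ is any injection. (1) $\mathsf{RQEA}_\alpha$ is not axiomatizable by a finite schema over $\mathsf{RCA}_\alpha$: there is no finite set $E$ of equations in the language of $\mathsf{QEA}_\omega$ such that for every $\mathfrak A\in\mathsf{QEA}_\alpha$, $$\mathfrak A\in\mathsf{RQEA}_\alpha\iff \mathfrak{Rd}_{ca}\mathfrak A\in\mathsf{RCA}_\alpha\text{ and }\mathfrak A\text{ satisfies all }\alpha\text{-instances of all }e\in E.$$ (2) There are algebras $\mathfrak B_n\in\mathsf{QEA}_\alpha$ ($n<\omega$) such that, for every $n$, $\mathfrak B_n\notin\mathsf{RQEA}_\alpha$ and $\mathfrak{Rd}_{ca}\mathfrak B_n\in\mathsf{RCA}_\alpha$, while for every nonprincipal ultrafilter $F$ on $\omega$ the ultraproduct $\prod_n\mathfrak B_n/F$ belongs to $\mathsf{RQEA}_\alpha$.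 -/

import Mathlib

universe u

/-- An algebra of the similarity type of `CA_I` (`I` is the set of dimensions):
Boolean operations, cylindrifications `c_i` and diagonal constants `d_ij`. No axioms are imposed. -/
structure CylAlg (I : Type u) where
  carrier : Type u
  add : carrier → carrier → carrier
  mul : carrier → carrier → carrier
  compl : carrier → carrier
  zero : carrier
  one : carrier
  cyl : I → carrier → carrier
  diag : I → I → carrier

/-- An algebra of the similarity type of `QEA_I`: it has in addition the replacement operations
`s_[i/j]` and the transposition operations `s_[i,j]`. No axioms are imposed.
The cylindric reduct `Rd_ca A` of `A : QPEAlg I` is `A.toCylAlg`. -/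
structure QPEAlg (I : Type u) extends CylAlg I where
  repl : I → I → carrier → carrier
  swap : I → I → carrier → carrier

/-- The Boolean part of the algebra is a Boolean algebra. -/
def CylAlg.IsBoolean {I : Type u} (A : CylAlg I) : Prop :=
  ∃ _ : BooleanAlgebra A.carrier,
    (∀ x y, A.add x y = x ⊔ y) ∧ (∀ x y, A.mul x y = x ⊓ y) ∧ (∀ x, A.compl x = xᶜ) ∧
      A.zero = ⊥ ∧ A.one = ⊤

/-- The operation `f` is an endomorphism of the Boolean part of `A`. -/
structure CylAlg.IsBoolEndo {I : Type u} (A : CylAlg I) (f : A.carrier → A.carrier) : Prop where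
  map_add : ∀ x y, f (A.add x y) = A.add (f x) (f y)
  map_mul : ∀ x y, f (A.mul x y) = A.mul (f x) (f y)
  map_compl : ∀ x, f (A.compl x) = A.compl (f x)
  map_zero : f A.zero = A.zero
  map_one : f A.one = A.one

/-- The class `QEA_I` of quasi-polyadic equality algebras of dimension `I`, in the
Sain–Thompson axiomatization. The relation `x ≤ y` is written `x + y = y`. -/
structure IsQEA {I : Type u} (A : QPEAlg I) : Prop where
  boolean : A.toCylAlg.IsBoolean
  repl_self : ∀ i x, A.repl i i x = x
  swap_self : ∀ i x, A.swap i i x = x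
  swap_comm : ∀ i j x, A.swap i j x = A.swap j i x
  le_cyl : ∀ i x, A.add x (A.cyl i x) = A.cyl i x
  cyl_add : ∀ i x y, A.cyl i (A.add x y) = A.add (A.cyl i x) (A.cyl i y)
  repl_cyl : ∀ i j x, A.repl i j (A.cyl i x) = A.cyl i x
  cyl_repl : ∀ i j x, i ≠ j → A.cyl i (A.repl i j x) = A.repl i j x
  repl_cyl_comm : ∀ i j k x, k ≠ i → k ≠ j →
    A.repl i j (A.cyl k x) = A.cyl k (A.repl i j x)
  repl_endo : ∀ i j, A.IsBoolEndo (A.repl i j)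
  swap_endo : ∀ i j, A.IsBoolEndo (A.swap i j)
  swap_swap : ∀ i j x, A.swap i j (A.swap i j x) = x
  swap_braid : ∀ i j k x, i ≠ j → i ≠ k → j ≠ k →
    A.swap i j (A.swap i k x) = A.swap j k (A.swap i j x)
  swap_repl : ∀ i j x, A.swap i j (A.repl i j x) = A.repl j i x
  repl_diag : ∀ i j, A.repl i j (A.diag i j) = A.one
  mul_diag_le : ∀ i j x, A.add (A.mul x (A.diag i j)) (A.repl i j x) = A.repl i j x

/-- `V` is a generalized Cartesian space of dimension `I`: a union of Cartesian spaces `^I (U k)`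
with pairwise disjoint nonempty bases `U k`. -/
def IsGenCartesianSpace {I S : Type u} (V : Set (I → S)) : Prop :=
  ∃ (K : Type u) (U : K → Set S), (∀ k, (U k).Nonempty) ∧
    (∀ k l, k ≠ l → Disjoint (U k) (U l)) ∧ V = {s | ∃ k, ∀ i, s i ∈ U k}

/-- The concrete cylindric algebra of all subsets of `V`. -/
def setCylAlg {I S : Type u} (V : Set (I → S)) : CylAlg I where
  carrier := Set V
  add X Y := X ∪ Y
  mul X Y := X ∩ Y
  compl X := Xᶜ
  zero := ∅
  one := Set.univ
  cyl i X := {s | ∃ t ∈ X, ∀ j, j ≠ i → t.1 j = s.1 j}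
  diag i j := {s | s.1 i = s.1 j}

/-- The concrete substitution `S_τ X = {s ∈ V : s ∘ τ ∈ X}`. -/
def setSubst {I S : Type u} (V : Set (I → S)) (τ : I → I) (X : Set V) : Set V :=
  {s | ∃ t ∈ X, t.1 = s.1 ∘ τ}

open Classical in
/-- The concrete quasi-polyadic equality algebra of all subsets of `V`; the map `[i/j]` sends `i`
to `j` and fixes everything else, and `[i,j]` is the transposition of `i` and `j`. -/
noncomputable def setQPEAlg {I S : Type u} (V : Set (I → S)) : QPEAlg I where
  toCylAlg := setCylAlg V
  repl i j X := setSubst V (Function.update id i j) X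
  swap i j X := setSubst V (Equiv.swap i j) X

/-- Homomorphisms of cylindric-type algebras. -/
structure CylAlg.IsHom {I : Type u} (A B : CylAlg I) (f : A.carrier → B.carrier) : Prop where
  map_add : ∀ x y, f (A.add x y) = B.add (f x) (f y)
  map_mul : ∀ x y, f (A.mul x y) = B.mul (f x) (f y)
  map_compl : ∀ x, f (A.compl x) = B.compl (f x)
  map_zero : f A.zero = B.zero
  map_one : f A.one = B.one
  map_cyl : ∀ i x, f (A.cyl i x) = B.cyl i (f x)
  map_diag : ∀ i j, f (A.diag i j) = B.diag i j

/-- Homomorphisms of quasi-polyadic-equality-type algebras. -/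
structure QPEAlg.IsHom {I : Type u} (A B : QPEAlg I) (f : A.carrier → B.carrier) : Prop where
  toCyl : CylAlg.IsHom A.toCylAlg B.toCylAlg f
  map_repl : ∀ i j x, f (A.repl i j x) = B.repl i j (f x)
  map_swap : ∀ i j x, f (A.swap i j x) = B.swap i j (f x)

/-- The class `RCA_I` of representable cylindric algebras: algebras isomorphic to a subalgebra of
the algebra of all subsets of a generalized Cartesian space. -/
def IsRCA {I : Type u} (A : CylAlg I) : Prop :=
  ∃ (S : Type u) (V : Set (I → S)), IsGenCartesianSpace V ∧
    ∃ f : A.carrier → (setCylAlg V).carrier, Function.Injective f ∧ A.IsHom (setCylAlg V) f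

/-- The class `RQEA_I` of representable quasi-polyadic equality algebras. -/
def IsRQEA {I : Type u} (A : QPEAlg I) : Prop :=
  ∃ (S : Type u) (V : Set (I → S)), IsGenCartesianSpace V ∧
    ∃ f : A.carrier → (setQPEAlg V).carrier, Function.Injective f ∧ A.IsHom (setQPEAlg V) f

/-- Terms of the language of `QEA_I`, with variables `v_0, v_1, …`. -/
inductive QTerm (I : Type u) : Type u
  | var : ℕ → QTerm I
  | zero : QTerm I
  | one : QTerm I
  | add : QTerm I → QTerm I → QTerm I
  | mul : QTerm I → QTerm I → QTerm I
  | compl : QTerm I → QTerm I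
  | cyl : I → QTerm I → QTerm I
  | diag : I → I → QTerm I
  | repl : I → I → QTerm I → QTerm I
  | swap : I → I → QTerm I → QTerm I

/-- The term `η⁺ t`, obtained from `t` by replacing every dimension index `i` by `η i`. -/
def QTerm.reindex {I : Type*} {J : Type*} (η : I → J) : QTerm I → QTerm J
  | var n => var n
  | zero => zero
  | one => one
  | add s t => add (s.reindex η) (t.reindex η)
  | mul s t => mul (s.reindex η) (t.reindex η)
  | compl t => compl (t.reindex η)
  | cyl i t => cyl (η i) (t.reindex η)
  | diag i j => diag (η i) (η j)
  | repl i j t => repl (η i) (η j) (t.reindex η)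
  | swap i j t => swap (η i) (η j) (t.reindex η)

/-- The value of a term in `A` under an assignment of the variables. -/
def QTerm.eval {I : Type u} (A : QPEAlg I) (a : ℕ → A.carrier) : QTerm I → A.carrier
  | var n => a n
  | zero => A.zero
  | one => A.one
  | add s t => A.add (s.eval A a) (t.eval A a)
  | mul s t => A.mul (s.eval A a) (t.eval A a)
  | compl t => A.compl (t.eval A a)
  | cyl i t => A.cyl i (t.eval A a)
  | diag i j => A.diag i j
  | repl i j t => A.repl i j (t.eval A a)
  | swap i j t => A.swap i j (t.eval A a)

/-- A schema (in the sense of Monk) is given by a set of equations, that is, pairs of terms, of the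
language of dimension `ω`. The algebra `A` of dimension `I` satisfies it if it satisfies all
`I`-instances `η⁺ e` of its members `e`, where `η : ω → I` is any injection. -/
def SatisfiesSchema {I : Type u} (A : QPEAlg I) (E : Set (QTerm ℕ × QTerm ℕ)) : Prop :=
  ∀ e ∈ E, ∀ η : ℕ → I, Function.Injective η → ∀ a : ℕ → A.carrier,
    (e.1.reindex η).eval A a = (e.2.reindex η).eval A a

/-- The ultraproduct `Π B_n / F`. -/
def ultraproduct {I : Type u} (F : Ultrafilter ℕ) (B : ℕ → QPEAlg I) : QPEAlg I where
  carrier := (F : Filter ℕ).Product (fun n => (B n).carrier)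
  add := Quotient.map₂ (fun x y n => (B n).add (x n) (y n)) (fun _ _ h _ _ h' => by
    filter_upwards [h, h'] with n hn hn'
    rw [hn, hn'])
  mul := Quotient.map₂ (fun x y n => (B n).mul (x n) (y n)) (fun _ _ h _ _ h' => by
    filter_upwards [h, h'] with n hn hn'
    rw [hn, hn'])
  compl := Quotient.map (fun x n => (B n).compl (x n)) (fun _ _ h => by
    filter_upwards [h] with n hn
    rw [hn])
  zero := Quotient.mk _ (fun n => (B n).zero)
  one := Quotient.mk _ (fun n => (B n).one)
  cyl i := Quotient.map (fun x n => (B n).cyl i (x n)) (fun _ _ h => by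
    filter_upwards [h] with n hn
    rw [hn])
  diag i j := Quotient.mk _ (fun n => (B n).diag i j)
  repl i j := Quotient.map (fun x n => (B n).repl i j (x n)) (fun _ _ h => by
    filter_upwards [h] with n hn
    rw [hn])
  swap i j := Quotient.map (fun x n => (B n).swap i j (x n)) (fun _ _ h => by
    filter_upwards [h] with n hn
    rw [hn])

/-! The obstruction is a parity argument about edge colourings. Sequences take values in points `(l,
z)` with a label `l` in `I` and a value `z` in `Z`. An element of `colorAlg` is a set of coloured
sequences in which the colour is visible only at split sequences: those with distinct points and
exactly one pair of coordinates sharing a label. Cylindrifications forget the colour; transpositions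
keep it.

In a representation, fix all coordinates except the two that share a label. The points of this label
form a set `M` of at most `card Z` elements, every ordered pair of distinct points of `M` has one
colour, and every point sees every colour. Transpositions make the colouring symmetric. If `card C +
1 = card Z` is odd, each colour is a perfect matching of an odd set, which is absurd
(`no_full_edge_coloring`, `colorAlg.not_isRQEA`).

The cylindric reduct needs no symmetry. If `Z` is a field and `C` its group of units, the difference
of the two values, multiplied by a regularized product of all other values, is an asymmetric
colouring whose lines contain all colours (`exists_isFullColoring`).

When `Z` runs through the prime fields, an ultraproduct has infinitely many colours and parity
disappears. A map `h` from values to colours whose fibres have at least two elements yields a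
symmetric colouring, the regularized product of `h` over all coordinates
(`isRQEA_ultraproduct_colorAlg`).

A finite schema characterizing representability would fail in every factor. One equation would fail
almost everywhere, and permuting the dimensions moves the failures to a common instance, so the
schema would fail in the representable ultraproduct (`colorAlg.not_satisfiesSchema_ultraproduct`).
-/

open scoped Classical in
/-- `Φ` is a homomorphism of `A` into the cylindric algebra of all subsets of the Cartesian space
`I → U`. -/
structure CylAlg.IsFullRep {I : Type u} (A : CylAlg I) (U : Type u)
    (Φ : A.carrier → Set (I → U)) : Prop where
  map_add : ∀ x y, Φ (A.add x y) = Φ x ∪ Φ y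
  map_mul : ∀ x y, Φ (A.mul x y) = Φ x ∩ Φ y
  map_compl : ∀ x, Φ (A.compl x) = (Φ x)ᶜ
  map_zero : Φ A.zero = ∅
  map_one : Φ A.one = Set.univ
  mem_cyl : ∀ i x s, s ∈ Φ (A.cyl i x) ↔ ∃ y, Function.update s i y ∈ Φ x
  mem_diag : ∀ i j s, s ∈ Φ (A.diag i j) ↔ s i = s j

open scoped Classical in
/-- `Φ` is a homomorphism of `A` into the quasi-polyadic equality algebra of all subsets of the
Cartesian space `I → U`. -/
structure QPEAlg.IsFullRep {I : Type u} (A : QPEAlg I) (U : Type u)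
    (Φ : A.carrier → Set (I → U)) : Prop where
  toCyl : A.toCylAlg.IsFullRep U Φ
  mem_repl : ∀ i j x s, s ∈ Φ (A.repl i j x) ↔ s ∘ Function.update id i j ∈ Φ x
  mem_swap : ∀ i j x s, s ∈ Φ (A.swap i j x) ↔ s ∘ Equiv.swap i j ∈ Φ x

/-! ### Representability as separation by homomorphisms into full set algebras. -/

section SumSpace

variable {I : Type u} {K : Type u} {U : K → Type u}

/-- The disjoint union of the Cartesian spaces `I → U k`. -/
def sumSpace (I : Type u) {K : Type u} (U : K → Type u) : Set (I → Σ k, U k) :=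
  {s | ∃ k, ∀ i, (s i).1 = k}

/-- The point of the disjoint union given by a point of one of the components. -/
def sumSpace.mk (k : K) (t : I → U k) : sumSpace I U :=
  ⟨fun i => ⟨k, t i⟩, k, fun _ => rfl⟩

theorem sumSpace.exists_mk (s : sumSpace I U) : ∃ k t, s = sumSpace.mk k t := by
  have this : ∀ (k : K) (w : Σ k, U k) (h : w.1 = k), w = ⟨k, h ▸ w.2⟩ := by
    rintro _ w rfl
    rfl
  obtain ⟨s, k, hk⟩ := s
  refine ⟨k, fun i => hk i ▸ (s i).2, Subtype.ext (funext fun i => ?_)⟩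
  exact this _ _ (hk i)

theorem isGenCartesianSpace_sumSpace (hU : ∀ k, Nonempty (U k)) :
    IsGenCartesianSpace (sumSpace I U) := by
  refine ⟨K, fun k => {w | w.1 = k}, fun k => ⟨⟨k, (hU k).some⟩, rfl⟩, fun k l hkl => ?_, rfl⟩
  rw [Set.disjoint_left]
  rintro w rfl h
  exact hkl h

/-- The set of points of the disjoint union that correspond to the sets `Φ k x`. -/
def sumSpace.map {X : Type*} (Φ : ∀ k, X → Set (I → U k)) (x : X) : Set (sumSpace I U) :=
  {s | ∃ k, ∃ t ∈ Φ k x, s = sumSpace.mk k t}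

theorem sumSpace.mk_inj [Nonempty I] {k l : K} {t : I → U k} {t' : I → U l}
    (h : sumSpace.mk k t = sumSpace.mk l t') : ∃ e : k = l, e ▸ t = t' := by
  have h' : ∀ i, (⟨k, t i⟩ : Σ k, U k) = ⟨l, t' i⟩ := fun i =>
    congrFun (congrArg Subtype.val h) i
  obtain ⟨i⟩ := ‹Nonempty I›
  have e : k = l := congrArg Sigma.fst (h' i)
  subst e
  refine ⟨rfl, funext fun i => ?_⟩
  simpa using h' i

theorem sumSpace.mk_mem_map [Nonempty I] {X : Type*} (Φ : ∀ k, X → Set (I → U k)) (x : X) (k : K)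
    (t : I → U k) : sumSpace.mk k t ∈ sumSpace.map Φ x ↔ t ∈ Φ k x := by
  constructor
  · rintro ⟨l, t', ht', h⟩
    obtain ⟨rfl, rfl⟩ := sumSpace.mk_inj h
    exact ht'
  · exact fun h => ⟨k, t, h, rfl⟩

theorem sumSpace.map_injective [Nonempty I] {X : Type*} (Φ : ∀ k, X → Set (I → U k))
    (h : ∀ x y, x ≠ y → ∃ k, Φ k x ≠ Φ k y) : Function.Injective (sumSpace.map Φ) := by
  intro x y hxy
  by_contra hne
  obtain ⟨k, hk⟩ := h x y hne
  refine hk (Set.ext fun t => ?_)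
  rw [← sumSpace.mk_mem_map Φ, ← sumSpace.mk_mem_map Φ, hxy]

theorem CylAlg.isHom_sumSpace_map [Nontrivial I] {A : CylAlg I}
    {Φ : ∀ k, A.carrier → Set (I → U k)} (h : ∀ k, A.IsFullRep (U k) (Φ k)) :
    A.IsHom (setCylAlg (sumSpace I U)) (sumSpace.map Φ) := by
  classical
  constructor
  · intro x y
    refine Set.ext fun s => ?_
    obtain ⟨k, t, rfl⟩ := sumSpace.exists_mk s
    change _ ↔ _ ∈ _ ∪ _
    simp only [sumSpace.mk_mem_map, (h k).map_add, Set.mem_union]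
  · intro x y
    refine Set.ext fun s => ?_
    obtain ⟨k, t, rfl⟩ := sumSpace.exists_mk s
    change _ ↔ _ ∈ _ ∩ _
    simp only [sumSpace.mk_mem_map, (h k).map_mul, Set.mem_inter_iff]
  · intro x
    refine Set.ext fun s => ?_
    obtain ⟨k, t, rfl⟩ := sumSpace.exists_mk s
    change _ ↔ _ ∈ _ᶜ
    simp only [sumSpace.mk_mem_map, (h k).map_compl, Set.mem_compl_iff]
  · refine Set.ext fun s => ?_
    obtain ⟨k, t, rfl⟩ := sumSpace.exists_mk s
    rw [sumSpace.mk_mem_map, (h k).map_zero]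
    rfl
  · refine Set.ext fun s => ?_
    obtain ⟨k, t, rfl⟩ := sumSpace.exists_mk s
    rw [sumSpace.mk_mem_map, (h k).map_one]
    exact ⟨fun _ => trivial, fun _ => trivial⟩
  · intro i x
    refine Set.ext fun s => ?_
    obtain ⟨k, t, rfl⟩ := sumSpace.exists_mk s
    rw [sumSpace.mk_mem_map, (h k).mem_cyl]
    change _ ↔ ∃ r ∈ sumSpace.map Φ x, _
    constructor
    · rintro ⟨y, hy⟩
      refine ⟨sumSpace.mk k (Function.update t i y), (sumSpace.mk_mem_map _ _ _ _).2 hy, ?_⟩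
      intro j hj
      simp [sumSpace.mk, hj]
    · rintro ⟨r, hr, hrs⟩
      obtain ⟨l, t', rfl⟩ := sumSpace.exists_mk r
      -- A second coordinate, untouched by `c_i`, keeps both points in the same component.
      obtain ⟨j, hj⟩ := exists_ne i
      obtain rfl : l = k := congrArg Sigma.fst (hrs j hj)
      refine ⟨t' i, ?_⟩
      rw [sumSpace.mk_mem_map] at hr
      convert hr
      refine Function.update_eq_iff.2 ⟨rfl, fun j hj => ?_⟩
      have := hrs j hj
      simp only [sumSpace.mk] at this
      simpa using this.symm
  · intro i j
    refine Set.ext fun s => ?_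
    obtain ⟨k, t, rfl⟩ := sumSpace.exists_mk s
    rw [sumSpace.mk_mem_map, (h k).mem_diag]
    change _ ↔ (⟨k, t i⟩ : Σ k, U k) = ⟨k, t j⟩
    simp

theorem sumSpace.mk_mem_setSubst [Nonempty I] {X : Type*} {Φ : ∀ k, X → Set (I → U k)} {x : X}
    {k : K} {t : I → U k} (τ : I → I) :
    sumSpace.mk k t ∈ setSubst (sumSpace I U) τ (sumSpace.map Φ x) ↔ t ∘ τ ∈ Φ k x := by
  rw [← sumSpace.mk_mem_map]
  constructor
  · rintro ⟨r, hr, h⟩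
    have : r = sumSpace.mk k (t ∘ τ) := Subtype.ext h
    rwa [← this]
  · exact fun h => ⟨_, h, rfl⟩

theorem QPEAlg.isHom_sumSpace_map [Nontrivial I] {A : QPEAlg I}
    {Φ : ∀ k, A.carrier → Set (I → U k)} (h : ∀ k, A.IsFullRep (U k) (Φ k)) :
    A.IsHom (setQPEAlg (sumSpace I U)) (sumSpace.map Φ) := by
  classical
  refine ⟨CylAlg.isHom_sumSpace_map fun k => (h k).toCyl, fun i j x => ?_, fun i j x => ?_⟩
  · refine Set.ext fun s => ?_
    obtain ⟨k, t, rfl⟩ := sumSpace.exists_mk s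
    rw [sumSpace.mk_mem_map, (h k).mem_repl]
    exact (sumSpace.mk_mem_setSubst _).symm
  · refine Set.ext fun s => ?_
    obtain ⟨k, t, rfl⟩ := sumSpace.exists_mk s
    rw [sumSpace.mk_mem_map, (h k).mem_swap]
    exact (sumSpace.mk_mem_setSubst _).symm

end SumSpace

theorem nonempty_of_set_fun_ne {I : Type*} {U : Type*} [Nonempty I] {X Y : Set (I → U)}
    (h : X ≠ Y) : Nonempty U := by
  by_contra hU
  rw [not_nonempty_iff] at hU
  exact h (Subsingleton.elim _ _)

/-- An algebra whose elements are separated by homomorphisms into full cylindric set algebras is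
representable. -/
theorem isRCA_of_separating {I : Type u} [Nontrivial I] {A : CylAlg I}
    (h : ∀ x y, x ≠ y → ∃ (U : Type u) (Φ : A.carrier → Set (I → U)),
      A.IsFullRep U Φ ∧ Φ x ≠ Φ y) : IsRCA A := by
  choose U Φ hΦ hne using h
  -- One component of the space for each pair of elements to be separated.
  let K : Type u := {p : A.carrier × A.carrier // p.1 ≠ p.2}
  refine ⟨Σ k : K, U _ _ k.2, sumSpace I fun k : K => U _ _ k.2,
    isGenCartesianSpace_sumSpace fun k => nonempty_of_set_fun_ne (hne _ _ k.2),
    sumSpace.map fun k : K => Φ _ _ k.2,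
    sumSpace.map_injective _ fun x y hxy => ⟨⟨(x, y), hxy⟩, hne _ _ hxy⟩,
    CylAlg.isHom_sumSpace_map fun k => hΦ _ _ k.2⟩

/-- An algebra whose elements are separated by homomorphisms into full quasi-polyadic equality set
algebras is representable. -/
theorem isRQEA_of_separating {I : Type u} [Nontrivial I] {A : QPEAlg I}
    (h : ∀ x y, x ≠ y → ∃ (U : Type u) (Φ : A.carrier → Set (I → U)),
      A.IsFullRep U Φ ∧ Φ x ≠ Φ y) : IsRQEA A := by
  choose U Φ hΦ hne using h
  let K : Type u := {p : A.carrier × A.carrier // p.1 ≠ p.2}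
  refine ⟨Σ k : K, U _ _ k.2, sumSpace I fun k : K => U _ _ k.2,
    isGenCartesianSpace_sumSpace fun k => nonempty_of_set_fun_ne (hne _ _ k.2),
    sumSpace.map fun k : K => Φ _ _ k.2,
    sumSpace.map_injective _ fun x y hxy => ⟨⟨(x, y), hxy⟩, hne _ _ hxy⟩,
    QPEAlg.isHom_sumSpace_map fun k => hΦ _ _ k.2⟩

/-- Homomorphisms into full set algebras separate the elements of a representable algebra. -/
theorem IsRQEA.exists_isFullRep {I : Type u} [Nontrivial I] {A : QPEAlg I} (h : IsRQEA A)
    {x y : A.carrier} (hxy : x ≠ y) : ∃ (U : Type u) (Φ : A.carrier → Set (I → U)),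
      A.IsFullRep U Φ ∧ Φ x ≠ Φ y := by
  classical
  obtain ⟨S, V, ⟨K, B, hB, hdisj, hV⟩, f', hf, hhom⟩ := h
  let f : A.carrier → Set V := f'
  let emb (k : K) (s : I → B k) : V := ⟨fun i => (s i).1, hV ▸ ⟨k, fun i => (s i).2⟩⟩
  have hemb : ∀ v : V, ∃ k s, v = emb k s := by
    rintro ⟨v, hv'⟩
    obtain ⟨k, hv⟩ := hV ▸ hv'
    exact ⟨k, fun i => ⟨v i, hv i⟩, rfl⟩
  let Φ (k : K) (x : A.carrier) : Set (I → B k) := {s | emb k s ∈ f x}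
  obtain ⟨k, hk⟩ : ∃ k, Φ k x ≠ Φ k y := by
    by_contra! hc
    refine hxy (hf (Set.ext fun v => ?_))
    obtain ⟨k, s, rfl⟩ := hemb v
    exact Set.ext_iff.1 (hc k) s
  have hsub : ∀ (τ : I → I) (X : Set V) s, emb k s ∈ setSubst V τ X ↔ emb k (s ∘ τ) ∈ X := by
    intro τ X s
    constructor
    · rintro ⟨r, hr, h⟩
      have : r = emb k (s ∘ τ) := Subtype.ext h
      rwa [← this]
    · exact fun h => ⟨_, h, rfl⟩
  have hc := hhom.toCyl
  refine ⟨B k, Φ k, ⟨⟨?_, ?_, ?_, ?_, ?_, ?_, ?_⟩, ?_, ?_⟩, hk⟩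
  · intro x y
    exact congrArg (fun X : Set V => {s | emb k s ∈ X}) (hc.map_add x y)
  · intro x y
    exact congrArg (fun X : Set V => {s | emb k s ∈ X}) (hc.map_mul x y)
  · intro x
    exact congrArg (fun X : Set V => {s | emb k s ∈ X}) (hc.map_compl x)
  · exact congrArg (fun X : Set V => {s | emb k s ∈ X}) hc.map_zero
  · exact congrArg (fun X : Set V => {s | emb k s ∈ X}) hc.map_one
  · intro i x s
    refine (Set.ext_iff.1 (hc.map_cyl i x) (emb k s)).trans ?_
    change (∃ t ∈ f x, _) ↔ _
    constructor
    · rintro ⟨t, ht, hts⟩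
      obtain ⟨l, t, rfl⟩ := hemb t
      obtain ⟨j, hj⟩ := exists_ne i
      have hkl : k = l := by
        by_contra hne
        refine Set.disjoint_left.1 (hdisj k l hne) (s j).2 ?_
        have := hts j hj
        change (t j).1 = (s j).1 at this
        rw [← this]
        exact (t j).2
      subst hkl
      refine ⟨t i, ?_⟩
      change emb k _ ∈ f x
      convert ht
      exact Function.update_eq_iff.2 ⟨rfl, fun j hj => Subtype.ext (hts j hj).symm⟩
    · rintro ⟨y, hy⟩
      refine ⟨_, hy, fun j hj => ?_⟩
      simp [emb, hj]
  · intro i j s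
    refine (Set.ext_iff.1 (hc.map_diag i j) (emb k s)).trans ?_
    exact Subtype.ext_iff.symm
  · intro i j x s
    exact (Set.ext_iff.1 (hhom.map_repl i j x) (emb k s)).trans (hsub _ _ _)
  · intro i j x s
    exact (Set.ext_iff.1 (hhom.map_swap i j x) (emb k s)).trans (hsub _ _ _)

/-- A subalgebra of a Boolean algebra of sets is Boolean. -/
theorem CylAlg.isBoolean_of_injective {I : Type u} {A : CylAlg I} {Q : Type*}
    (f : A.carrier → Set Q) (hf : Function.Injective f)
    (map_add : ∀ x y, f (A.add x y) = f x ∪ f y) (map_mul : ∀ x y, f (A.mul x y) = f x ∩ f y)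
    (map_compl : ∀ x, f (A.compl x) = (f x)ᶜ) (map_zero : f A.zero = ∅)
    (map_one : f A.one = Set.univ) : A.IsBoolean := by
  let _ : Max A.carrier := ⟨A.add⟩
  let _ : Min A.carrier := ⟨A.mul⟩
  let _ : LE A.carrier := ⟨fun x y => f x ≤ f y⟩
  let _ : LT A.carrier := ⟨fun x y => f x < f y⟩
  let _ : Top A.carrier := ⟨A.one⟩
  let _ : Bot A.carrier := ⟨A.zero⟩
  let _ : Compl A.carrier := ⟨A.compl⟩
  let _ : SDiff A.carrier := ⟨fun x y => A.mul x (A.compl y)⟩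
  let _ : HImp A.carrier := ⟨fun x y => A.add y (A.compl x)⟩
  refine ⟨hf.booleanAlgebra f Iff.rfl Iff.rfl map_add map_mul map_one map_zero map_compl
    (fun x y => ?_) (fun x y => ?_), fun _ _ => rfl, fun _ _ => rfl, fun _ => rfl, rfl, rfl⟩
  · change f (A.mul x (A.compl y)) = _
    rw [map_mul, map_compl]
    rfl
  · change f (A.add y (A.compl x)) = _
    rw [map_add, map_compl, himp_eq]
    rfl

/-! ### Types of sequences, split sequences and saturated sets. -/

section SameType

variable {I : Type u} {Z : Type}

/-- Two sequences of labelled points have the same labels and the same coincidences. -/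
def SameType (s t : I → I × Z) : Prop :=
  (∀ i, (s i).1 = (t i).1) ∧ ∀ i j, s i = s j ↔ t i = t j

theorem SameType.refl (s : I → I × Z) : SameType s s :=
  ⟨fun _ => rfl, fun _ _ => Iff.rfl⟩

theorem SameType.symm {s t : I → I × Z} (h : SameType s t) : SameType t s :=
  ⟨fun i => (h.1 i).symm, fun i j => (h.2 i j).symm⟩

theorem SameType.trans {s t r : I → I × Z} (h : SameType s t) (h' : SameType t r) :
    SameType s r :=
  ⟨fun i => (h.1 i).trans (h'.1 i), fun i j => (h.2 i j).trans (h'.2 i j)⟩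

theorem SameType.comp {s t : I → I × Z} (h : SameType s t) (τ : I → I) :
    SameType (s ∘ τ) (t ∘ τ) :=
  ⟨fun i => h.1 (τ i), fun i j => h.2 (τ i) (τ j)⟩

/-- Within one label, `s i ↦ t i` is a well-defined injection between subsets of `Z`, because the
coincidences agree; as `Z` is finite it extends to a permutation of `Z`. This transports a change of
one coordinate from `s` to `t`, so cylindrifications preserve saturation. -/
theorem SameType.exists_injective [Finite Z] {s t : I → I × Z} (h : SameType s t) :
    ∃ G : I × Z → I × Z, Function.Injective G ∧ (∀ w, (G w).1 = w.1) ∧ ∀ i, G (s i) = t i := by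
  classical
  have := Fintype.ofFinite Z
  have key : ∀ l : I, ∃ g : Z → Z, Function.Injective g ∧
      ∀ i, (s i).1 = l → g (s i).2 = (t i).2 := by
    intro l
    let A : Set Z := {z | ∃ i, s i = (l, z)}
    let f : Z → Z := fun z => if hz : ∃ i, s i = (l, z) then (t hz.choose).2 else z
    have hf : ∀ i z, s i = (l, z) → t i = (l, f z) := by
      intro i z hi
      have hz : ∃ i, s i = (l, z) := ⟨i, hi⟩
      have e : t i = t hz.choose := (h.2 _ _).1 (hi.trans hz.choose_spec.symm)
      refine Prod.ext ?_ ?_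
      · rw [← h.1, hi]
      · simp only [f, dif_pos hz, e]
    have hinj : Set.InjOn f A := by
      rintro z ⟨i, hi⟩ z' ⟨j, hj⟩ hzz
      have : t i = t j := by rw [hf i z hi, hf j z' hj, hzz]
      have := (h.2 _ _).2 this
      rw [hi, hj] at this
      exact congrArg Prod.snd this
    obtain ⟨g, hg⟩ := Set.MapsTo.exists_equiv_extend_of_card_eq (t := Finset.univ)
      (Finset.card_univ).symm (s := A) (f := f) (fun _ _ => by simp) hinj
    refine ⟨fun z => g z, fun z z' hzz => g.injective (Subtype.ext hzz), fun i hi => ?_⟩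
    have hs : s i = (l, (s i).2) := Prod.ext hi rfl
    refine (hg _ ⟨i, hs⟩).trans ?_
    rw [hf i _ hs]
  choose g hg hgs using key
  refine ⟨fun w => (w.1, g w.1 w.2), ?_, fun _ => rfl, fun i => Prod.ext (h.1 i) (hgs _ i rfl)⟩
  rintro ⟨l, z⟩ ⟨l', z'⟩ hww
  obtain ⟨rfl, h2⟩ := Prod.ext_iff.1 hww
  exact Prod.ext rfl (hg _ h2)

open scoped Classical in
theorem SameType.exists_update [Finite Z] {s t : I → I × Z} (h : SameType s t) (i : I)
    (y : I × Z) : ∃ y', SameType (Function.update s i y) (Function.update t i y') := by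
  obtain ⟨G, hG, hG1, hGs⟩ := h.exists_injective
  obtain rfl : G ∘ s = t := funext hGs
  refine ⟨G y, ?_⟩
  rw [← Function.comp_update]
  exact ⟨fun j => (hG1 _).symm, fun j k => hG.eq_iff.symm⟩

open scoped Classical in
theorem SameType.update_self {s : I → I × Z} (hs : Function.Injective s) {i : I} {y : I × Z}
    (h1 : y.1 = (s i).1) (h2 : ∀ k, k ≠ i → s k ≠ y) : SameType (Function.update s i y) s := by
  refine ⟨fun j => ?_, fun j k => ?_⟩
  · by_cases hj : j = i
    · subst hj; simpa using h1
    · simp [hj]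
  · rw [hs.eq_iff]
    by_cases hj : j = i <;> by_cases hk : k = i
    · simp [hj, hk]
    · subst hj
      simp only [Function.update_self, Function.update_of_ne hk]
      exact ⟨fun h => absurd h.symm (h2 k hk), fun h => absurd h.symm hk⟩
    · subst hk
      simp only [Function.update_self, Function.update_of_ne hj]
      exact ⟨fun h => absurd h (h2 j hj), fun h => absurd h hj⟩
    · simp only [Function.update_of_ne hk, Function.update_of_ne hj, hs.eq_iff]

/-- The labels of exactly one pair of indices coincide, namely those of `a` and `b`. -/
def DoubleAt (l : I → I) (a b : I) : Prop :=
  a ≠ b ∧ l a = l b ∧ ∀ k k', l k = l k' → k = k' ∨ (k = a ∧ k' = b) ∨ (k = b ∧ k' = a)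

/-- The sequence is injective and the labels of exactly one pair of its members coincide. -/
def IsSplit (s : I → I × Z) : Prop :=
  Function.Injective s ∧ ∃ a b, DoubleAt (fun i => (s i).1) a b

theorem IsSplit.of_sameType {s t : I → I × Z} (hs : IsSplit s) (h : SameType s t) :
    IsSplit t := by
  refine ⟨fun i j hij => hs.1 ((h.2 i j).2 hij), ?_⟩
  have : (fun i => (t i).1) = fun i => (s i).1 := funext fun i => (h.1 i).symm
  rw [this]
  exact hs.2

theorem IsSplit.comp_perm {s : I → I × Z} (hs : IsSplit s) (π : Equiv.Perm I) :
    IsSplit (s ∘ π) := by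
  obtain ⟨hs, a, b, hab, h1, h2⟩ := hs
  refine ⟨hs.comp π.injective, π.symm a, π.symm b, by simpa using hab, by simpa using h1,
    fun k k' hk => ?_⟩
  have := h2 _ _ hk
  simpa [Equiv.eq_symm_apply] using this

theorem isSplit_comp_perm {s : I → I × Z} (π : Equiv.Perm I) : IsSplit (s ∘ π) ↔ IsSplit s := by
  refine ⟨fun h => ?_, fun h => h.comp_perm π⟩
  have := h.comp_perm π.symm
  rwa [Function.comp_assoc, Equiv.self_comp_symm] at this

-- Proper replacements destroy injectivity, so they never see a colour.
open scoped Classical in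
theorem not_isSplit_comp_update {s : I → I × Z} {i j : I} (hij : i ≠ j) :
    ¬ IsSplit (s ∘ Function.update id i j) := by
  intro h
  exact hij (h.1 (by simp [hij.symm]))

/-- A set of coloured sequences is saturated if it is invariant under `SameType` and, except for
split sequences, under changes of the colour. -/
def IsSaturated {C : Type} (X : Set ((I → I × Z) × C)) : Prop :=
  ∀ s t c d, SameType s t → (IsSplit s → c = d) → (s, c) ∈ X → (t, d) ∈ X

theorem IsSaturated.compl {C : Type} {X : Set ((I → I × Z) × C)} (h : IsSaturated X) :
    IsSaturated Xᶜ :=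
  fun _ _ _ _ hst hc hX hX' =>
    hX (h _ _ _ _ hst.symm (fun ht => (hc (ht.of_sameType hst.symm)).symm) hX')

end SameType

/-! ### The colour algebra, its axioms and its symmetry under permutations of the dimensions. -/

open scoped Classical in
/-- The algebra of all saturated sets of coloured sequences; cylindrifications ignore the colours,
substitutions respect them. -/
noncomputable def colorAlg (I : Type u) (Z C : Type) [Finite Z] : QPEAlg I where
  carrier := {X : Set ((I → I × Z) × C) // IsSaturated X}
  add X Y := ⟨X.1 ∪ Y.1, fun s t c d h hc hX =>
    hX.imp (X.2 s t c d h hc) (Y.2 s t c d h hc)⟩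
  mul X Y := ⟨X.1 ∩ Y.1, fun s t c d h hc hX =>
    hX.imp (X.2 s t c d h hc) (Y.2 s t c d h hc)⟩
  compl X := ⟨X.1ᶜ, X.2.compl⟩
  zero := ⟨∅, fun _ _ _ _ _ _ h => h⟩
  one := ⟨Set.univ, fun _ _ _ _ _ _ h => h⟩
  cyl i X := ⟨{p | ∃ y d, (Function.update p.1 i y, d) ∈ X.1}, by
    rintro s t c d h - ⟨y, d', hX⟩
    obtain ⟨y', hy'⟩ := h.exists_update i y
    exact ⟨y', d', X.2 _ _ _ _ hy' (fun _ => rfl) hX⟩⟩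
  diag i j := ⟨{p | p.1 i = p.1 j}, fun _ _ _ _ h _ hX => (h.2 i j).1 hX⟩
  repl i j X := ⟨{p | (p.1 ∘ Function.update id i j, p.2) ∈ X.1}, by
    intro s t c d h hc hX
    refine X.2 _ _ _ _ (h.comp _) (fun hs => ?_) hX
    by_cases hij : i = j
    · subst hij
      rw [show Function.update id i i = (id : I → I) from Function.update_eq_self i id] at hs
      exact hc hs
    · exact absurd hs (not_isSplit_comp_update hij)⟩
  swap i j X := ⟨{p | (p.1 ∘ Equiv.swap i j, p.2) ∈ X.1}, by
    intro s t c d h hc hX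
    exact X.2 _ _ _ _ (h.comp _) (fun hs => hc ((isSplit_comp_perm _).1 hs)) hX⟩

namespace colorAlg

variable {I : Type u} {Z C : Type} [Finite Z]

open scoped Classical in
theorem mem_cyl (i : I) (X : (colorAlg I Z C).carrier) (s c) :
    (s, c) ∈ ((colorAlg I Z C).cyl i X).1 ↔ ∃ y d, (Function.update s i y, d) ∈ X.1 :=
  Iff.rfl

theorem mem_diag (i j : I) (s c) : (s, c) ∈ ((colorAlg I Z C).diag i j).1 ↔ s i = s j :=
  Iff.rfl

open scoped Classical in
theorem mem_repl (i j : I) (X : (colorAlg I Z C).carrier) (s c) :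
    (s, c) ∈ ((colorAlg I Z C).repl i j X).1 ↔ (s ∘ Function.update id i j, c) ∈ X.1 :=
  Iff.rfl

open scoped Classical in
theorem mem_swap (i j : I) (X : (colorAlg I Z C).carrier) (s c) :
    (s, c) ∈ ((colorAlg I Z C).swap i j X).1 ↔ (s ∘ Equiv.swap i j, c) ∈ X.1 :=
  Iff.rfl

theorem mem_add (X Y : (colorAlg I Z C).carrier) (p) :
    p ∈ ((colorAlg I Z C).add X Y).1 ↔ p ∈ X.1 ∨ p ∈ Y.1 :=
  Iff.rfl

theorem mem_mul (X Y : (colorAlg I Z C).carrier) (p) :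
    p ∈ ((colorAlg I Z C).mul X Y).1 ↔ p ∈ X.1 ∧ p ∈ Y.1 :=
  Iff.rfl

theorem mem_compl (X : (colorAlg I Z C).carrier) (p) :
    p ∈ ((colorAlg I Z C).compl X).1 ↔ p ∉ X.1 :=
  Iff.rfl

theorem mem_one (p) : p ∈ ((colorAlg I Z C).one).1 := trivial

theorem notMem_zero (p) : p ∉ ((colorAlg I Z C).zero).1 := fun h => h

theorem ext {X Y : (colorAlg I Z C).carrier} (h : ∀ s c, (s, c) ∈ X.1 ↔ (s, c) ∈ Y.1) : X = Y :=
  Subtype.ext (Set.ext fun p => h p.1 p.2)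

/-- The colour algebra is a quasi-polyadic equality algebra. -/
theorem isQEA : IsQEA (colorAlg I Z C) := by
  classical
  have upd : ∀ i : I, (Function.update id i i : I → I) = id := fun i =>
    Function.update_eq_self i id
  refine ⟨CylAlg.isBoolean_of_injective (fun X => X.1) Subtype.val_injective (fun _ _ => rfl)
    (fun _ _ => rfl) (fun _ => rfl) rfl rfl, ?_, ?_, ?_, ?_, ?_, ?_, ?_, ?_, ?_, ?_, ?_, ?_, ?_,
    ?_, ?_⟩
  · intro i x
    refine ext fun s c => ?_
    rw [mem_repl]
    convert Iff.rfl using 3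
    exact congrArg (fun τ => s ∘ τ) (upd i).symm
  · intro i x
    refine ext fun s c => ?_
    rw [mem_swap, Equiv.swap_self]
    rfl
  · intro i j x
    refine ext fun s c => ?_
    rw [mem_swap, mem_swap, Equiv.swap_comm]
  · intro i x
    refine ext fun s c => ?_
    rw [mem_add, mem_cyl]
    refine or_iff_right_of_imp fun h => ⟨s i, c, ?_⟩
    rwa [Function.update_eq_self]
  · intro i x y
    refine ext fun s c => ?_
    simp only [mem_add, mem_cyl, exists_or]
  · intro i j x
    refine ext fun s c => ?_
    simp only [mem_cyl, mem_repl]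
    refine exists_congr fun y => exists_congr fun d => ?_
    convert Iff.rfl using 3
    ext k : 1
    by_cases hk : k = i <;> simp [hk, Function.update_of_ne]
  · intro i j x hij
    refine ext fun s c => ?_
    simp only [mem_cyl, mem_repl]
    have e : ∀ y, Function.update s i y ∘ Function.update id i j = s ∘ Function.update id i j := by
      intro y
      ext k : 1
      by_cases hk : k = i
      · subst hk; simp [hij.symm]
      · simp [hk]
    simp only [e]
    constructor
    -- The colour `d` supplied by `c_i` may differ from `c`, which is harmless because the sequence
    -- is not split.
    · rintro ⟨-, d, h⟩
      exact x.2 _ _ _ _ (SameType.refl _) (fun hs => absurd hs (not_isSplit_comp_update hij)) h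
    · exact fun h => ⟨s i, c, h⟩
  · intro i j k x hki hkj
    refine ext fun s c => ?_
    simp only [mem_cyl, mem_repl]
    refine exists_congr fun y => exists_congr fun d => ?_
    convert Iff.rfl using 3
    ext l : 1
    by_cases hl : l = i
    · subst hl; simp [hki.symm, hkj.symm]
    · by_cases hl' : l = k <;> simp [hl, hl', hki]
  · exact fun i j => ⟨fun _ _ => rfl, fun _ _ => rfl, fun _ => rfl, rfl, rfl⟩
  · exact fun i j => ⟨fun _ _ => rfl, fun _ _ => rfl, fun _ => rfl, rfl, rfl⟩
  · intro i j x
    refine ext fun s c => ?_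
    rw [mem_swap, mem_swap, Function.comp_assoc, ← Equiv.coe_trans]
    simp
  · intro i j k x hij hik hjk
    refine ext fun s c => ?_
    simp only [mem_swap, Function.comp_assoc, ← Equiv.Perm.coe_mul]
    congr! 4
    ext l : 1
    simp only [Equiv.Perm.mul_apply, Equiv.swap_apply_def]
    split_ifs <;> simp_all
  · intro i j x
    refine ext fun s c => ?_
    simp only [mem_swap, mem_repl, Function.comp_assoc]
    congr! 4
    ext l : 1
    by_cases hli : l = i <;> by_cases hlj : l = j <;> by_cases hij : i = j <;>
      simp_all [Equiv.swap_apply_def]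
  · intro i j
    refine ext fun s c => ?_
    simp only [mem_repl, mem_diag, mem_one, iff_true]
    by_cases hij : j = i <;> simp [hij]
  · intro i j x
    refine ext fun s c => ?_
    rw [mem_add, mem_mul, mem_diag, mem_repl]
    refine or_iff_right_of_imp fun h => ?_
    convert h.1 using 2
    ext k : 1
    by_cases hk : k = i
    · subst hk; simp [h.2]
    · simp [hk]

/-- The action of a permutation of the dimensions on the colour algebra. -/
def perm (π : Equiv.Perm I) (X : (colorAlg I Z C).carrier) : (colorAlg I Z C).carrier :=
  ⟨{p | (p.1 ∘ π, p.2) ∈ X.1}, fun _ _ _ _ h hc hX =>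
    X.2 _ _ _ _ (h.comp π) (fun hs => hc ((isSplit_comp_perm π).1 hs)) hX⟩

theorem mem_perm (π : Equiv.Perm I) (X : (colorAlg I Z C).carrier) (s c) :
    (s, c) ∈ (perm π X).1 ↔ (s ∘ π, c) ∈ X.1 :=
  Iff.rfl

theorem perm_injective (π : Equiv.Perm I) :
    Function.Injective (perm (Z := Z) (C := C) π) := by
  intro X Y h
  refine ext fun s c => ?_
  have := congrArg (fun W => (s ∘ π.symm, c) ∈ W.1) h
  simpa [mem_perm, Function.comp_assoc] using this

/-- The definition of the algebra treats all dimensions alike. Hence an equation that fails for `η`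
also fails for `π ∘ η`, by `perm_injective`. -/
theorem eval_perm (π : Equiv.Perm I) (η : ℕ → I) (a : ℕ → (colorAlg I Z C).carrier)
    (t : QTerm ℕ) : (t.reindex (π ∘ η)).eval (colorAlg I Z C) (fun k => perm π (a k)) =
      perm π ((t.reindex η).eval (colorAlg I Z C) a) := by
  classical
  induction t with
  | var n => rfl
  | zero => rfl
  | one => rfl
  | add s t hs ht => exact congrArg₂ (colorAlg I Z C).add hs ht
  | mul s t hs ht => exact congrArg₂ (colorAlg I Z C).mul hs ht
  | compl t ht => exact congrArg (colorAlg I Z C).compl ht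
  | cyl i t ht =>
    refine (congrArg ((colorAlg I Z C).cyl _) ht).trans (ext fun s c => ?_)
    simp only [mem_cyl, mem_perm, QTerm.reindex, QTerm.eval]
    refine exists_congr fun y => exists_congr fun d => ?_
    convert Iff.rfl using 3
    exact (Function.update_comp_eq_of_injective s π.injective (η i) y).symm
  | diag i j => rfl
  | repl i j t ht =>
    refine (congrArg ((colorAlg I Z C).repl _ _) ht).trans (ext fun s c => ?_)
    simp only [mem_repl, mem_perm, QTerm.reindex, QTerm.eval, Function.comp_assoc]
    convert Iff.rfl using 4
    ext k : 1
    by_cases hk : k = η i <;> simp [hk]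
  | swap i j t ht =>
    refine (congrArg ((colorAlg I Z C).swap _ _) ht).trans (ext fun s c => ?_)
    simp only [mem_swap, mem_perm, QTerm.reindex, QTerm.eval, Function.comp_assoc]
    convert Iff.rfl using 4
    ext k : 1
    exact (π.injective.swap_apply (η i) (η j) k).symm

end colorAlg

/-! ### Regularized products, asymmetric colourings and representability of the cylindric reduct. -/

open scoped Classical in
/-- A product over all coordinates that is regularized by a reference point in every class of
sequences that differ at finitely many coordinates only. -/
theorem exists_tailProd {I W K : Type*} [CommGroup K] (g : W → K) :
    ∃ Φ : (I → W) → K, ∀ s i y, Φ (Function.update s i y) * g (s i) = Φ s * g y := by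
  let S : Setoid (I → W) :=
    ⟨fun s t => {i | s i ≠ t i}.Finite, fun s => by simp, fun {s t} h => by
      simpa only [ne_comm] using h, fun {s t r} h h' =>
        (h.union h').subset fun i hi => by
          by_contra hc
          simp only [Set.mem_union, Set.mem_ofPred_eq, not_or, not_not] at hc
          exact hi (hc.1.trans hc.2)⟩
  -- Dividing by the values at `ρ s`, which differs from `s` at finitely many places, leaves a
  -- product of finite support.
  let ρ : (I → W) → I → W := fun s => (Quotient.mk S s).out
  have hρ : ∀ s, {i | s i ≠ ρ s i}.Finite := fun s => S.symm (Quotient.mk_out (s := S) s)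
  have hupd : ∀ s i y, ρ (Function.update s i y) = ρ s := by
    intro s i y
    refine congrArg Quotient.out (Quotient.sound (s := S) ?_)
    refine (Set.finite_singleton i).subset fun j hj => ?_
    by_contra hji
    exact hj (Function.update_of_ne hji _ _)
  refine ⟨fun s => ∏ᶠ k, g (s k) / g (ρ s k), fun s i y => ?_⟩
  have e : ∀ k, g (Function.update s i y k) / g (ρ s k) =
      (g (s k) / g (ρ s k)) * (if k = i then g y / g (s i) else 1) := by
    intro k
    by_cases hk : k = i
    · subst hk
      simp only [Function.update_self, if_true]
      rw [mul_comm, div_mul_div_cancel]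
    · simp [hk]
  simp only [hupd, e]
  rw [finprod_mul_distrib, finprod_eq_single (fun k => if k = i then g y / g (s i) else 1) i,
    if_pos rfl, mul_assoc, div_mul_cancel]
  · exact fun k hk => if_neg hk
  · refine (hρ s).subset fun k hk hc => hk ?_
    simp only [hc, div_self']
  · refine (Set.finite_singleton i).subset fun k hk => ?_
    by_contra hc
    exact hk (if_neg hc)

-- A transposition is two successive updates whose factors cancel. This is the symmetry that will
-- let the ultraproduct represent transpositions.
open scoped Classical in
theorem apply_comp_swap_of_update {I W K : Type*} [CommGroup K] {g : W → K} {Φ : (I → W) → K}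
    (h : ∀ s i y, Φ (Function.update s i y) * g (s i) = Φ s * g y) (s : I → W) (i j : I) :
    Φ (s ∘ Equiv.swap i j) = Φ s := by
  by_cases hij : i = j
  · subst hij
    simp
  have e : s ∘ Equiv.swap i j = Function.update (Function.update s i (s j)) j (s i) := by
    ext k : 1
    by_cases hk : k = j
    · subst hk; simp
    · by_cases hk' : k = i
      · subst hk'; simp [hk]
      · simp [hk, hk', Equiv.swap_apply_of_ne_of_ne]
  have h1 := h (Function.update s i (s j)) j (s i)
  rw [Function.update_of_ne (Ne.symm hij), h s i (s j), ← e] at h1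
  exact mul_right_cancel h1

section Coloring

variable {I : Type u} {Z C : Type}

open scoped Classical in
/-- Every line through a split sequence `s` contains points of every colour that have the
same type as `s`. -/
def IsFullColoring (f : (I → I × Z) → C) : Prop :=
  ∀ s, IsSplit s → ∀ i d, ∃ y, SameType (Function.update s i y) s ∧ f (Function.update s i y) = d

/-- Only cylindrification needs an argument: a witness may carry a colour `d` other than the one
given by `f`. If its sequence is split, the line contains a point of the same type with `f`-colour
`d`; otherwise saturation ignores the colour. -/
theorem colorAlg.isFullRep_of_isFullColoring [Finite Z] {f : (I → I × Z) → C}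
    (hf : IsFullColoring f) :
    (colorAlg I Z C).toCylAlg.IsFullRep (I × Z) (fun X => {s | (s, f s) ∈ X.1}) := by
  classical
  refine ⟨fun _ _ => rfl, fun _ _ => rfl, fun _ => rfl, rfl, rfl, fun i X s => ?_,
    fun i j s => Iff.rfl⟩
  refine (colorAlg.mem_cyl i X s (f s)).trans ⟨?_, ?_⟩
  · rintro ⟨y, d, h⟩
    by_cases hs : IsSplit (Function.update s i y)
    · obtain ⟨y', h1, h2⟩ := hf _ hs i d
      rw [Function.update_idem] at h1 h2
      exact ⟨y', X.2 _ _ _ _ h1.symm (fun _ => h2.symm) h⟩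
    · exact ⟨y, X.2 _ _ _ _ (SameType.refl _) (fun h => absurd h hs) h⟩
  · exact fun ⟨y, h⟩ => ⟨y, _, h⟩

/-- A single homomorphism separates everything: by fullness, saturated sets cannot distinguish a
given `(s, c)` from some `(t, f t)`. -/
theorem colorAlg.isRCA_of_isFullColoring [Finite Z] [Nontrivial I] {f : (I → I × Z) → C}
    (hf : IsFullColoring f) : IsRCA (colorAlg I Z C).toCylAlg := by
  classical
  refine isRCA_of_separating fun X Y hXY =>
    ⟨_, _, colorAlg.isFullRep_of_isFullColoring hf, fun h => hXY (colorAlg.ext fun s c => ?_)⟩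
  obtain ⟨t, hst, ht⟩ : ∃ t, SameType s t ∧ (IsSplit s → c = f t) := by
    by_cases hs : IsSplit s
    · obtain ⟨y, h1, h2⟩ := hf s hs (Classical.arbitrary I) c
      exact ⟨_, h1.symm, fun _ => h2.symm⟩
    · exact ⟨s, SameType.refl s, fun h => absurd h hs⟩
  have key : ∀ W : (colorAlg I Z C).carrier, (s, c) ∈ W.1 ↔ (t, f t) ∈ W.1 := fun W =>
    ⟨W.2 _ _ _ _ hst ht, W.2 _ _ _ _ hst.symm fun h => (ht (h.of_sameType hst.symm)).symm⟩
  rw [key, key]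
  exact Set.ext_iff.1 h t

open scoped Classical in
/-- The unit given by a nonzero element of a field, and `1` for zero. -/
noncomputable def unitOrOne {F : Type*} [Field F] (z : F) : Fˣ :=
  if h : z = 0 then 1 else Units.mk0 z h

theorem unitOrOne_coe {F : Type*} [Field F] (d : Fˣ) : unitOrOne (d : F) = d := by
  simp [unitOrOne]

section Cancel

variable {G : Type*}

theorem add_cancel_aux₁ [AddCommGroup G] (d p u v w : G) :
    d + -p + u + v + (p + w - u) - (w + v) = d := by abel

theorem add_cancel_aux₂ [AddCommGroup G] (d p u v w : G) :
    d + -p + u + v + (p + w - u) - (v + w) = d := by abel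

theorem add_cancel_aux₃ [AddCommGroup G] (d p u v w x : G) :
    x + (p + (d + -p + u + v + w - x) - u) - (v + w) = d := by abel

theorem mul_cancel_aux₁ [CommGroup G] (d p u v w : G) :
    d * p⁻¹ * u * v * (p * w / u) / (w * v) = d :=
  add_cancel_aux₁ (G := Additive G) d p u v w

theorem mul_cancel_aux₂ [CommGroup G] (d p u v w : G) :
    d * p⁻¹ * u * v * (p * w / u) / (v * w) = d :=
  add_cancel_aux₂ (G := Additive G) d p u v w

theorem mul_cancel_aux₃ [CommGroup G] (d p u v w x : G) :
    x * (p * (d * p⁻¹ * u * v * w / x) / u) / (v * w) = d :=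
  add_cancel_aux₃ (G := Additive G) d p u v w x

end Cancel

/-- Let `a, b` be the coordinates sharing a label. The colour is the difference of their values
times the regularized product over the remaining coordinates. Moving `a` or `b` without collision,
the difference runs through all units; moving another coordinate, its own factor does. Interchanging
`a` and `b` changes the sign, so symmetry is lost in odd characteristic. -/
theorem exists_isFullColoring (I : Type u) [Nonempty I] (F : Type) [Field F] :
    ∃ f : (I → I × F) → Fˣ, IsFullColoring f := by
  classical
  obtain ⟨Φ, hΦ⟩ := exists_tailProd (I := I) (fun w : I × F => unitOrOne w.2)
  have hΦ' : ∀ s i y, Φ (Function.update s i y) = Φ s * unitOrOne y.2 / unitOrOne (s i).2 :=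
    fun s i y => eq_div_iff_mul_eq'.2 (hΦ s i y)
  -- The order of the pair is chosen from the labels alone, so it is constant while a value changes.
  have hpair : ∃ p : (I → I) → I × I, ∀ l, (∃ a b, DoubleAt l a b) →
      DoubleAt l (p l).1 (p l).2 := by
    have : ∀ l : I → I, ∃ q : I × I, (∃ a b, DoubleAt l a b) → DoubleAt l q.1 q.2 := by
      intro l
      by_cases h : ∃ a b, DoubleAt l a b
      · obtain ⟨a, b, h⟩ := h
        exact ⟨(a, b), fun _ => h⟩
      · exact ⟨Classical.arbitrary _, fun h' => absurd h' h⟩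
    exact Classical.axiomOfChoice this
  obtain ⟨p, hp⟩ := hpair
  let L : (I → I × F) → I → I := fun s i => (s i).1
  refine ⟨fun s => unitOrOne ((s (p (L s)).1).2 - (s (p (L s)).2).2) * Φ s /
    (unitOrOne (s (p (L s)).1).2 * unitOrOne (s (p (L s)).2).2), fun s hs i d => ?_⟩
  have hd := hp _ hs.2
  have hL : ∀ z, L (Function.update s i ((s i).1, z)) = L s := by
    intro z
    ext k : 1
    by_cases hk : k = i
    · subst hk; simp [L]
    · simp [L, hk]
  change DoubleAt (L s) _ _ at hd
  generalize hab : p (L s) = q at hd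
  obtain ⟨a, b⟩ := q
  obtain ⟨hne, hlab, huniq⟩ := hd
  simp only at hne hlab huniq
  suffices h : ∃ z, (∀ k, k ≠ i → s k ≠ ((s i).1, z)) ∧
      unitOrOne ((Function.update s i ((s i).1, z) a).2 - (Function.update s i ((s i).1, z) b).2) *
        (Φ s * unitOrOne z / unitOrOne (s i).2) /
    (unitOrOne (Function.update s i ((s i).1, z) a).2 *
      unitOrOne (Function.update s i ((s i).1, z) b).2) = d by
    obtain ⟨z, h1, h2⟩ := h
    refine ⟨((s i).1, z), SameType.update_self hs.1 rfl h1, ?_⟩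
    simp only [hL, hab, hΦ']
    exact h2
  have hpt : ∀ {k z}, s k = ((s i).1, z) → L s k = L s i :=
    fun {k z} h => show (s k).1 = (s i).1 by rw [h]
  by_cases hia : i = a
  · subst hia
    -- The difference required for colour `d`: the factor of the new value in `Φ` cancels against
    -- the denominator. As `c` is nonzero, the new point avoids `s b`.
    let c : Fˣ := d * (Φ s)⁻¹ * unitOrOne (s i).2 * unitOrOne (s b).2
    refine ⟨(s b).2 + c, fun k hk hsk => ?_, ?_⟩
    · rcases huniq k i (hpt hsk) with h | ⟨h, -⟩ | ⟨rfl, -⟩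
      · exact hk h
      · exact hk h
      · have := congrArg Prod.snd hsk
        simp at this
    · simp only [Function.update_self, Function.update_of_ne hne.symm, add_sub_cancel_left,
        unitOrOne_coe, c]
      exact mul_cancel_aux₁ _ _ _ _ _
  by_cases hib : i = b
  · subst hib
    let c : Fˣ := d * (Φ s)⁻¹ * unitOrOne (s i).2 * unitOrOne (s a).2
    refine ⟨(s a).2 - c, fun k hk hsk => ?_, ?_⟩
    · rcases huniq k i (hpt hsk) with h | ⟨rfl, -⟩ | ⟨h, -⟩
      · exact hk h
      · have := congrArg Prod.snd hsk
        exact c.ne_zero (sub_eq_self.1 this.symm)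
      · exact hk h
    · simp only [Function.update_self, Function.update_of_ne hne, sub_sub_cancel,
        unitOrOne_coe, c]
      exact mul_cancel_aux₂ _ _ _ _ _
  -- No other coordinate has the label of `s i`, so no value is forbidden and the equation for its
  -- factor can be solved.
  · let c : Fˣ := d * (Φ s)⁻¹ * unitOrOne (s i).2 * unitOrOne (s a).2 * unitOrOne (s b).2 /
      unitOrOne ((s a).2 - (s b).2)
    refine ⟨c, fun k hk hsk => ?_, ?_⟩
    · rcases huniq k i (hpt hsk) with h | ⟨-, h⟩ | ⟨-, h⟩
      · exact hk h
      · exact hib h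
      · exact hia h
    · simp only [Function.update_of_ne (Ne.symm hia), Function.update_of_ne (Ne.symm hib),
        unitOrOne_coe, c]
      exact mul_cancel_aux₃ _ _ _ _ _ _

end Coloring

/-! ### The parity obstruction to representing transpositions. -/

/-- There is no symmetric edge colouring of the complete graph on a nonempty set `M`, of at most
`card C + 1` vertices, in which every vertex sees every colour, if `card C + 1` is odd. -/
theorem no_full_edge_coloring {U : Type*} {C : Type*} [Fintype C] [Nonempty C] {M : Set U}
    (hM : M.Nonempty) (hodd : Odd (Fintype.card C + 1))
    (hcard : ∀ y : Fin (Fintype.card C + 2) → U, Function.Injective y → ∃ a, y a ∉ M)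
    {E : U → U → C → Prop} (hE : ∀ y z c, E y z c → z ∈ M ∧ y ≠ z)
    (huniq : ∀ y z c c', E y z c → E y z c' → c = c') (hsymm : ∀ y z c, E y z c → E z y c)
    (hline : ∀ y ∈ M, ∀ c, ∃ z, E y z c) : False := by
  classical
  have hfin : Finite M := by
    by_contra hinf
    rw [not_finite_iff_infinite] at hinf
    obtain ⟨a, ha⟩ := hcard (fun a => (Infinite.natEmbedding M a : U))
      (Subtype.val_injective.comp ((Infinite.natEmbedding M).injective.comp Fin.val_injective))
    exact ha (Subtype.mem _)
  have := Fintype.ofFinite M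
  have hle : Fintype.card M ≤ Fintype.card C + 1 := by
    by_contra hlt
    obtain ⟨e⟩ : Nonempty (Fin (Fintype.card C + 2) ↪ M) :=
      Function.Embedding.nonempty_of_card_le (by rw [Fintype.card_fin]; omega)
    obtain ⟨a, ha⟩ := hcard (fun a => (e a : U)) (Subtype.val_injective.comp e.injective)
    exact ha (Subtype.mem _)
  have hline' : ∀ y : M, ∀ c, ∃ z : {z : M // z ≠ y}, E y z.1 c := by
    intro y c
    obtain ⟨z, hz⟩ := hline y y.2 c
    exact ⟨⟨⟨z, (hE _ _ _ hz).1⟩, fun h => (hE _ _ _ hz).2 (congrArg Subtype.val h).symm⟩, hz⟩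
  choose φ hφ using hline'
  have hinj : ∀ y, Function.Injective (φ y) := fun y c c' h =>
    huniq _ _ _ _ (hφ y c) (h ▸ hφ y c')
  have hcard' : ∀ y : M, Fintype.card {z : M // z ≠ y} = Fintype.card M - 1 := fun y => by
    simp [Fintype.card_subtype_compl]
  obtain ⟨y₀⟩ : Nonempty M := hM.to_subtype
  have hpos : 0 < Fintype.card M := Fintype.card_pos_iff.2 ⟨y₀⟩
  -- Different colours at `y₀` lead to different neighbours, which gives the lower bound.
  have hMc : Fintype.card M = Fintype.card C + 1 := by
    have := Fintype.card_le_of_injective _ (hinj y₀)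
    rw [hcard'] at this
    omega
  have hsurj : ∀ y, Function.Surjective (φ y) := fun y =>
    ((Fintype.bijective_iff_injective_and_card _).2 ⟨hinj y, by rw [hcard', hMc]; rfl⟩).2
  obtain ⟨c⟩ := ‹Nonempty C›
  -- By symmetry and uniqueness of colours, following the edge of colour `c` is a fixed-point-free
  -- involution of `M`, so `card M` is even.
  have hinv : ∀ y : M, (φ (φ y c).1 c).1 = y := by
    intro y
    have h1 := hsymm _ _ _ (hφ y c)
    obtain ⟨c', hc'⟩ := hsurj (φ y c).1 ⟨y, (φ y c).2.symm⟩
    have h2 := hφ (φ y c).1 c'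
    rw [hc'] at h2
    obtain rfl := huniq _ _ _ _ h1 h2
    rw [hc']
  have hsum : ∑ _y : M, (1 : ZMod 2) = 0 :=
    Finset.sum_involution (fun y _ => (φ y c).1) (fun _ _ => by decide)
      (fun y _ _ => (φ y c).2) (fun _ _ => Finset.mem_univ _) (fun y _ => hinv y)
  rw [← hMc] at hodd
  rw [Finset.sum_const, Finset.card_univ, nsmul_eq_mul, mul_one,
    ZMod.natCast_eq_zero_iff_even] at hsum
  exact Nat.not_even_iff_odd.2 hodd hsum

namespace colorAlg

variable {I : Type u} {Z C : Type} [Finite Z] {U : Type u}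
  {Φ : (colorAlg I Z C).carrier → Set (I → U)}

/-- The complements of the `Y c` meet in zero. `Φ` is only known to preserve finite meets, which is
why `κ` is finite. -/
theorem exists_mem_of_isFullRep (h : (colorAlg I Z C).toCylAlg.IsFullRep U Φ) {κ : Type*}
    [Finite κ] (Y : κ → (colorAlg I Z C).carrier) (hY : ∀ p, ∃ c, p ∈ (Y c).1) (s : I → U) :
    ∃ c, s ∈ Φ (Y c) := by
  classical
  have := Fintype.ofFinite κ
  by_contra! hs
  have key : ∀ S : Finset κ, ∃ W : (colorAlg I Z C).carrier,
      (∀ p ∈ W.1, ∀ c ∈ S, p ∉ (Y c).1) ∧ s ∈ Φ W := by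
    intro S
    induction S using Finset.induction with
    | empty => exact ⟨(colorAlg I Z C).one, by simp, by rw [h.map_one]; trivial⟩
    | insert c S hc ih =>
      obtain ⟨W, h1, h2⟩ := ih
      refine ⟨(colorAlg I Z C).mul W ((colorAlg I Z C).compl (Y c)), fun p hp c' hc' => ?_, ?_⟩
      · rw [mem_mul, mem_compl] at hp
        rcases Finset.mem_insert.1 hc' with rfl | hc'
        · exact hp.2
        · exact h1 p hp.1 c' hc'
      · rw [h.map_mul, h.map_compl]
        exact ⟨h2, hs c⟩
  obtain ⟨W, h1, h2⟩ := key Finset.univ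
  have : W = (colorAlg I Z C).zero := ext fun s c => by
    obtain ⟨d, hd⟩ := hY (s, c)
    exact ⟨fun h => absurd hd (h1 _ h d (Finset.mem_univ _)), fun h => absurd h (notMem_zero _)⟩
  rw [this, h.map_zero] at h2
  exact h2

/-- Homomorphisms preserve the validity of clauses. -/
theorem exists_mem_of_forall_mem (h : (colorAlg I Z C).toCylAlg.IsFullRep U Φ) {ι κ : Type*}
    [Finite ι] [Finite κ] (X : ι → (colorAlg I Z C).carrier) (Y : κ → (colorAlg I Z C).carrier)
    (hXY : ∀ p, (∀ a, p ∈ (X a).1) → ∃ c, p ∈ (Y c).1) {s : I → U} (hs : ∀ a, s ∈ Φ (X a)) :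
    ∃ c, s ∈ Φ (Y c) := by
  obtain ⟨c | a, hc⟩ := exists_mem_of_isFullRep h
    (Sum.elim Y fun a => (colorAlg I Z C).compl (X a)) (fun p => by
      by_cases hp : ∀ a, p ∈ (X a).1
      · obtain ⟨c, hc⟩ := hXY p hp
        exact ⟨Sum.inl c, hc⟩
      · obtain ⟨a, ha⟩ := not_forall.1 hp
        exact ⟨Sum.inr a, ha⟩) s
  · exact ⟨c, hc⟩
  · rw [Sum.elim_inr, h.map_compl] at hc
    exact absurd (hs a) hc

theorem isFullRep_mono (h : (colorAlg I Z C).toCylAlg.IsFullRep U Φ)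
    {X Y : (colorAlg I Z C).carrier} (hXY : X.1 ⊆ Y.1) : Φ X ⊆ Φ Y := by
  intro s hs
  obtain ⟨-, hc⟩ := exists_mem_of_forall_mem h (fun _ : Unit => X) (fun _ : Unit => Y)
    (fun p hp => ⟨(), hXY (hp ())⟩) (fun _ => hs)
  exact hc

/-- The element saying that the `i`-th coordinate has label `l`. -/
def label (l i : I) : (colorAlg I Z C).carrier :=
  ⟨{p | (p.1 i).1 = l}, fun _ _ _ _ h _ hX => (h.1 i).symm.trans hX⟩

/-- The element saying that a sequence has the type of `s`. -/
def ofType (s : I → I × Z) : (colorAlg I Z C).carrier :=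
  ⟨{p | SameType p.1 s}, fun _ _ _ _ h _ hX => h.symm.trans hX⟩

/-- The element saying that a sequence has the type of the split sequence `s` and colour `c`. -/
def ofColor {s : I → I × Z} (hs : IsSplit s) (c : C) : (colorAlg I Z C).carrier :=
  ⟨{p | SameType p.1 s ∧ p.2 = c}, fun _ _ _ _ h hc hX =>
    ⟨h.symm.trans hX.1, (hc (hs.of_sameType hX.1.symm)).symm.trans hX.2⟩⟩

open scoped Classical in
/-- Membership in the image of a `label` element depends on one coordinate only. -/
theorem mem_label_congr (h : (colorAlg I Z C).toCylAlg.IsFullRep U Φ) (l i : I) {s t : I → U}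
    (hst : {k | s k ≠ t k}.Finite) (hi : s i = t i) :
    s ∈ Φ (label l i) ↔ t ∈ Φ (label l i) := by
  -- `label l i` is a fixed point of `c_k` for `k ≠ i`; finitely many such changes are then made one
  -- at a time.
  have step : ∀ (s : I → U) (k : I) (y : U), k ≠ i → Function.update s k y ∈ Φ (label l i) →
      s ∈ Φ (label l i) := by
    intro s k y hk hs
    have : (colorAlg I Z C).cyl k (label l i) = label l i := by
      refine ext fun r c => ?_
      rw [mem_cyl]
      simp only [label, Set.mem_ofPred_eq, Function.update_of_ne hk.symm]
      exact ⟨fun ⟨_, _, h⟩ => h, fun h => ⟨r i, c, h⟩⟩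
    rw [← this, h.mem_cyl]
    exact ⟨y, hs⟩
  have key : ∀ (S : Finset I) (s t : I → U), (∀ k, k ∉ S → s k = t k) → s i = t i →
      t ∈ Φ (label l i) → s ∈ Φ (label l i) := by
    intro S
    induction S using Finset.induction with
    | empty =>
      intro s t hst _ ht
      rwa [funext fun k => hst k (Finset.notMem_empty k)]
    | insert k S hk ih =>
      intro s t hst hi ht
      by_cases hki : k = i
      · refine ih s t (fun k' hk' => ?_) hi ht
        by_cases hkk : k' = k
        · rw [hkk, hki, hi]
        · exact hst k' (by simp [hkk, hk'])
      · refine step s k (t k) hki (ih _ t (fun k' hk' => ?_) ?_ ht)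
        · by_cases hkk : k' = k
          · subst hkk; simp
          · rw [Function.update_of_ne hkk]
            exact hst k' (by simp [hkk, hk'])
        · rw [Function.update_of_ne (Ne.symm hki), hi]
  have hS : ∀ k, k ∉ hst.toFinset → s k = t k := fun k hk => by simpa using hk
  exact ⟨key _ t s (fun k hk => (hS k hk).symm) hi.symm, key _ s t hS hi⟩

/-- With an odd number of points of each label and one colour less, the colour algebra is not
representable. -/
theorem not_isRQEA (I : Type u) [Infinite I] (Z C : Type) [Fintype Z] [Fintype C] [Nonempty C]
    (hZC : Fintype.card C + 1 = Fintype.card Z) (hodd : Odd (Fintype.card Z)) :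
    ¬ IsRQEA (colorAlg I Z C) := by
  classical
  intro hrep
  obtain ⟨i₀, i₁, hi⟩ := exists_pair_ne I
  obtain ⟨z₀, z₁, hz⟩ : ∃ z₀ z₁ : Z, z₀ ≠ z₁ := by
    have : Nontrivial Z := Fintype.one_lt_card_iff_nontrivial.1 (by
      have := Fintype.card_pos (α := C)
      omega)
    exact exists_pair_ne Z
  -- Each coordinate carries its own index as label, except that `i₁` borrows the label `i₀`.
  let s₀ : I → I × Z := fun k => if k = i₁ then (i₀, z₁) else (k, z₀)
  have hs₀ : IsSplit s₀ := by
    refine ⟨fun k k' hk => ?_, i₀, i₁, hi, ?_, fun k k' hk => ?_⟩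
    · by_cases h1 : k = i₁ <;> by_cases h2 : k' = i₁ <;> simp_all [s₀]
    · simp [s₀, hi]
    · by_cases h1 : k = i₁ <;> by_cases h2 : k' = i₁ <;> simp_all [s₀]
  have s₀0 : (s₀ i₀).1 = i₀ := by simp [s₀, hi]
  have s₀1 : (s₀ i₁).1 = i₀ := by simp [s₀]
  obtain ⟨c₀⟩ := ‹Nonempty C›
  obtain ⟨U, Φ, hΦ, hne⟩ := hrep.exists_isFullRep
    (x := ofColor hs₀ c₀) (y := (colorAlg I Z C).zero)
    (fun h => notMem_zero (s₀, c₀) (h ▸ ⟨SameType.refl _, rfl⟩))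
  have hc := hΦ.toCyl
  rw [hc.map_zero] at hne
  obtain ⟨v, hv⟩ := Set.nonempty_iff_ne_empty.2 hne
  let M : Set U := {y | Function.update v i₀ y ∈ Φ (label i₀ i₀)}
  have hM : ∀ (s : I → U) (j : I), {k | s k ≠ v k}.Finite →
      (s ∈ Φ (label i₀ j) ↔ s j ∈ M) := by
    intro s j hs
    have e : (label i₀ j : (colorAlg I Z C).carrier) =
        (colorAlg I Z C).repl i₀ j (label i₀ i₀) := by
      refine ext fun r c => ?_
      rw [mem_repl]
      simp [label]
    rw [e, hΦ.mem_repl]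
    refine mem_label_congr hc _ _ ?_ (by simp)
    refine (hs.union (Set.finite_singleton i₀)).subset fun k hk => ?_
    by_contra hk'
    simp only [Set.mem_union, Set.mem_ofPred_eq, Set.mem_singleton_iff, not_or, not_not] at hk'
    simp [hk'] at hk
  let Q : U → U → I → U := fun y z => Function.update (Function.update v i₀ y) i₁ z
  have hQfin : ∀ y z, {k | Q y z k ≠ v k}.Finite := by
    intro y z
    refine ((Set.finite_singleton i₀).union (Set.finite_singleton i₁)).subset fun k hk => ?_
    by_contra hk'
    simp only [Set.mem_union, Set.mem_singleton_iff, not_or] at hk'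
    simp [Q, hk'] at hk
  have hQ0 : ∀ y z, Q y z i₀ = y := fun y z => by simp [Q, hi]
  have hQ1 : ∀ y z, Q y z i₁ = z := fun y z => by simp [Q]
  have hsub0 : ∀ c, Φ (ofColor hs₀ c) ⊆ Φ (label i₀ i₀) := fun c =>
    isFullRep_mono hc fun p hp => (hp.1.1 i₀).trans s₀0
  have hsub1 : ∀ c, Φ (ofColor hs₀ c) ⊆ Φ (label i₀ i₁) := fun c =>
    isFullRep_mono hc fun p hp => (hp.1.1 i₁).trans s₀1
  have hsubd : ∀ c s, s ∈ Φ (ofColor hs₀ c) → s i₀ ≠ s i₁ := by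
    intro c s hs
    have : s ∈ Φ ((colorAlg I Z C).compl ((colorAlg I Z C).diag i₀ i₁)) :=
      isFullRep_mono hc (X := ofColor hs₀ c)
        (Y := (colorAlg I Z C).compl ((colorAlg I Z C).diag i₀ i₁)) (fun p hp h => hi ((hs₀.of_sameType hp.1.symm).1 h)) hs
    rw [hc.map_compl] at this
    exact fun h => this ((hc.mem_diag _ _ _).2 h)
  have hvfin : {k | v k ≠ v k}.Finite := by simp
  have hv0 : v i₀ ∈ M := (hM v i₀ hvfin).1 (hsub0 _ hv)
  have hv1 : v i₁ ∈ M := (hM v i₁ hvfin).1 (hsub1 _ hv)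
  have hv01 := hsubd _ _ hv
  have hE : ∀ y z c, Q y z ∈ Φ (ofColor hs₀ c) → z ∈ M ∧ y ≠ z := by
    intro y z c h
    refine ⟨?_, ?_⟩
    · have := (hM _ i₁ (hQfin y z)).1 (hsub1 _ h)
      rwa [hQ1] at this
    · have := hsubd _ _ h
      rwa [hQ0, hQ1] at this
  -- The type of `s₀` is determined by the labels at `i₀` and `i₁`, the inequality of these two
  -- points, and the other coordinates; the last are controlled by `c_{i₀} c_{i₁}` of the type.
  have hex : ∀ y ∈ M, ∀ z ∈ M, y ≠ z → ∃ c, Q y z ∈ Φ (ofColor hs₀ c) := by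
    intro y hy z hz hyz
    have h1 : Q y z ∈ Φ (label i₀ i₀) := (hM _ _ (hQfin y z)).2 (by rwa [hQ0])
    have h2 : Q y z ∈ Φ (label i₀ i₁) := (hM _ _ (hQfin y z)).2 (by rwa [hQ1])
    have h3 : Q y z ∈ Φ ((colorAlg I Z C).compl ((colorAlg I Z C).diag i₀ i₁)) := by
      rw [hc.map_compl]
      intro h
      rw [hc.mem_diag, hQ0, hQ1] at h
      exact hyz h
    have h4 : Q y z ∈ Φ ((colorAlg I Z C).cyl i₀ ((colorAlg I Z C).cyl i₁ (ofType s₀))) := by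
      rw [hc.mem_cyl]
      refine ⟨v i₀, ?_⟩
      rw [hc.mem_cyl]
      refine ⟨v i₁, ?_⟩
      have : Function.update (Function.update (Q y z) i₀ (v i₀)) i₁ (v i₁) = v := by
        ext k : 1
        by_cases hk : k = i₁
        · subst hk; simp
        · by_cases hk' : k = i₀
          · subst hk'; simp [hk]
          · simp [Q, hk, hk']
      rw [this]
      exact isFullRep_mono hc (X := ofColor hs₀ c₀) (Y := ofType s₀) (fun p hp => hp.1) hv
    have h5 := (Set.ext_iff.1 (hc.map_mul _ _) _).2 ⟨(Set.ext_iff.1 (hc.map_mul _ _) _).2 ⟨h1, h2⟩,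
      (Set.ext_iff.1 (hc.map_mul _ _) _).2 ⟨h3, h4⟩⟩
    refine exists_mem_of_forall_mem hc (fun _ : Unit => _) (fun c => ofColor hs₀ c) ?_
      (fun _ => h5)
    rintro ⟨r, c⟩ hr
    obtain ⟨⟨hr0, hr1⟩, hrd, y', d, z', d', hr2⟩ := hr ()
    refine ⟨c, ?_, rfl⟩
    change (r i₀).1 = i₀ at hr0
    change (r i₁).1 = i₀ at hr1
    change ¬ r i₀ = r i₁ at hrd
    change SameType (Function.update (Function.update r i₀ y') i₁ z') s₀ at hr2
    have hoth : ∀ k, k ≠ i₀ → k ≠ i₁ → (r k).1 = k := by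
      intro k h0 h1
      have := hr2.1 k
      simpa [h0, h1, s₀] using this
    refine ⟨fun k => ?_, fun k k' => ?_⟩
    · by_cases h1 : k = i₁
      · rw [h1, hr1, s₀1]
      · by_cases h0 : k = i₀
        · rw [h0, hr0, s₀0]
        · simp [hoth k h0 h1, s₀, h1]
    · rw [hs₀.1.eq_iff]
      refine ⟨fun hkk => ?_, fun h => congrArg r h⟩
      have hlab : (r k).1 = (r k').1 := congrArg Prod.fst hkk
      clear h1 h2 h3 h4 h5 hr2 hE hM hv hv0 hv1 hv01 hsub0 hsub1 hsubd
      by_cases h0 : k = i₀ <;> by_cases h1 : k = i₁ <;> by_cases h0' : k' = i₀ <;>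
        by_cases h1' : k' = i₁ <;> grind
  refine no_full_edge_coloring (C := C) (M := M) ⟨_, hv0⟩ (hZC ▸ hodd) ?_
    (E := fun y z c => Q y z ∈ Φ (ofColor hs₀ c)) hE ?_ ?_ ?_
  -- Pigeonhole: place `card C + 2 = card Z + 1` points of `M` at distinct coordinates. In the
  -- algebra, so many points of one label cannot be distinct.
  · intro y hy
    by_contra! hyM
    let j : Fin (Fintype.card C + 2) → I := fun a => Infinite.natEmbedding I a
    have hj : Function.Injective j :=
      (Infinite.natEmbedding I).injective.comp Fin.val_injective
    let s : I → U := Function.extend j y v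
    have hsj : ∀ a, s (j a) = y a := fun a => hj.extend_apply _ _ _
    have hsfin : {k | s k ≠ v k}.Finite := by
      refine (Set.finite_range j).subset fun k hk => ?_
      by_contra hk'
      exact hk (Function.extend_apply' _ _ _ hk')
    obtain ⟨⟨⟨a, b⟩, hab⟩, h⟩ := exists_mem_of_forall_mem hc (fun a => label i₀ (j a))
      (fun q : {q : Fin (Fintype.card C + 2) × Fin (Fintype.card C + 2) // q.1 ≠ q.2} =>
        (colorAlg I Z C).diag (j q.1.1) (j q.1.2)) (s := s) (fun p hp => by
          obtain ⟨a, b, hab, h⟩ := Fintype.exists_ne_map_eq_of_card_lt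
            (fun a => (p.1 (j a)).2) (by rw [Fintype.card_fin]; omega)
          exact ⟨⟨(a, b), hab⟩, Prod.ext ((hp a).trans (hp b).symm) h⟩)
        (fun a => (hM s _ hsfin).2 (by rw [hsj]; exact hyM a))
    rw [hc.mem_diag, hsj, hsj] at h
    exact hab (hy h)
  · intro y z c c' h h'
    by_contra hcc
    have := (Set.ext_iff.1 (hc.map_mul _ _) _).2 ⟨h, h'⟩
    have hzero : (colorAlg I Z C).mul (ofColor hs₀ c) (ofColor hs₀ c') =
        (colorAlg I Z C).zero := by
      refine ext fun r d => ⟨fun hr => absurd (hr.1.2.symm.trans hr.2.2) hcc, fun hr => ?_⟩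
      exact absurd hr (notMem_zero _)
    rw [hzero, hc.map_zero] at this
    exact this
  -- Both `i₀` and `i₁` carry the label `i₀`, so the transposition fixes each `ofColor hs₀ c`. Only
  -- here do transpositions enter the contradiction.
  · intro y z c h
    have e : ofColor hs₀ c = (colorAlg I Z C).swap i₀ i₁ (ofColor hs₀ c) := by
      have hs : SameType (s₀ ∘ Equiv.swap i₀ i₁) s₀ := by
        refine ⟨fun k => ?_, fun k k' => ?_⟩
        · by_cases h1 : k = i₁
          · subst h1; simp [s₀0, s₀1]
          · by_cases h0 : k = i₀
            · subst h0; simp [s₀0, s₀1]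
            · simp [Equiv.swap_apply_of_ne_of_ne h0 h1]
        · simp [hs₀.1.eq_iff]
      refine ext fun r d => ?_
      rw [mem_swap]
      refine and_congr_left fun _ => ⟨fun hr => (hr.comp _).trans hs, fun hr => ?_⟩
      have := (hr.comp (Equiv.swap i₀ i₁)).trans hs
      rwa [Function.comp_assoc, ← Equiv.Perm.coe_mul, Equiv.swap_mul_self] at this
    have : Q z y ∘ Equiv.swap i₀ i₁ = Q y z := by
      ext k : 1
      by_cases h1 : k = i₁
      · subst h1; simp [hQ0, hQ1]
      · by_cases h0 : k = i₀
        · subst h0; simp [hQ0, hQ1]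
        · simp [Equiv.swap_apply_of_ne_of_ne h0 h1, Q, h0, h1]
    change Q z y ∈ Φ (ofColor hs₀ c)
    rw [e, hΦ.mem_swap, this]
    exact h
  · intro y hy c
    -- Some edge leaves `y`; cylindrification forgets its colour, so an edge of colour `c` leaves
    -- `y` as well.
    obtain ⟨z, hz, hyz⟩ : ∃ z ∈ M, y ≠ z := by
      by_cases h : y = v i₀
      · exact ⟨v i₁, hv1, h ▸ hv01⟩
      · exact ⟨v i₀, hv0, h⟩
    obtain ⟨c', hc'⟩ := hex y hy z hz hyz
    have : Φ (ofColor hs₀ c') ⊆ Φ ((colorAlg I Z C).cyl i₁ (ofColor hs₀ c)) :=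
      isFullRep_mono hc fun p hp => ⟨p.1 i₁, c, by
        rw [Function.update_eq_self]
        exact ⟨hp.1, rfl⟩⟩
    obtain ⟨z', hz'⟩ := (hc.mem_cyl _ _ _).1 (this hc')
    refine ⟨z', ?_⟩
    simpa only [Q, Function.update_idem] using hz'

end colorAlg

/-! ### Symmetric colourings and representability of ultraproducts. -/

section Ultraproduct

variable {I : Type u} {Z C : ℕ → Type} {F : Ultrafilter ℕ}

/-- The element of an ultraproduct of types given by a sequence. -/
def toProduct {ε : ℕ → Type*} (F : Ultrafilter ℕ) (x : ∀ n, ε n) : (F : Filter ℕ).Product ε :=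
  Quotient.mk _ x

theorem toProduct_eq {ε : ℕ → Type*} {x y : ∀ n, ε n} :
    toProduct F x = toProduct F y ↔ ∀ᶠ n in F, x n = y n :=
  Quotient.eq (r := Filter.productSetoid (F : Filter ℕ) ε)

theorem exists_toProduct {ε : ℕ → Type*} (x : (F : Filter ℕ).Product ε) :
    ∃ y, toProduct F y = x :=
  Quotient.exists_rep x

theorem exists_section_toProduct {ε : ℕ → Type*} (x : ∀ n, ε n) :
    ∃ ρ : (F : Filter ℕ).Product ε → ∀ n, ε n,
      (∀ w, toProduct F (ρ w) = w) ∧ ρ (toProduct F x) = x := by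
  classical
  choose ρ hρ using exists_toProduct (F := F) (ε := ε)
  refine ⟨Function.update ρ (toProduct F x) x, fun w => ?_, by simp⟩
  by_cases hw : w = toProduct F x
  · subst hw; simp
  · rw [Function.update_of_ne hw, hρ]

/-- The map between ultraproducts of types given by a sequence of maps. -/
def productMap {ε ε' : ℕ → Type*} (F : Ultrafilter ℕ) (f : ∀ n, ε n → ε' n) :
    (F : Filter ℕ).Product ε → (F : Filter ℕ).Product ε' :=
  Quotient.map (fun x n => f n (x n)) fun _ _ h => by
    filter_upwards [h] with n hn
    rw [hn]

-- At most one other coordinate shares the label of `s i`, so at most one value can cause a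
-- collision.
open scoped Classical in
theorem IsSplit.exists_forbidden {Z : Type} {s : I → I × Z} (hs : IsSplit s) (i : I) :
    ∃ q, ∀ z, z ≠ q → SameType (Function.update s i ((s i).1, z)) s := by
  obtain ⟨hinj, a, b, hab, -, huniq⟩ := hs
  by_cases h : ∃ k, k ≠ i ∧ (s k).1 = (s i).1
  · obtain ⟨k, hk, hki⟩ := h
    refine ⟨(s k).2, fun z hz => SameType.update_self hinj rfl fun k' hk' hsk => hz ?_⟩
    have : k' = k := by
      have h1 := huniq k i hki
      have h2 := huniq k' i (congrArg (fun w : I × Z => w.1) hsk :)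
      grind
    rw [← this, hsk]
  · push Not at h
    exact ⟨(s i).2, fun z hz => SameType.update_self hinj rfl fun k hk hsk =>
      h k hk (congrArg (fun w : I × Z => w.1) hsk :)⟩

/-- The internal sequence given by a sequence in an ultraproduct and by representatives of the
elements of the ultraproduct. -/
def liftSeq (ch : I → (F : Filter ℕ).Product (fun n => I × Z n) → ∀ n, I × Z n)
    (s : I → (F : Filter ℕ).Product fun n => I × Z n) (n : ℕ) (i : I) : I × Z n :=
  ch i (s i) n

variable {ch : I → (F : Filter ℕ).Product (fun n => I × Z n) → ∀ n, I × Z n}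

open scoped Classical in
theorem liftSeq_update (s : I → (F : Filter ℕ).Product fun n => I × Z n) (i : I) (y) (n : ℕ) :
    liftSeq ch (Function.update s i y) n = Function.update (liftSeq ch s n) i (ch i y n) := by
  ext k : 1
  by_cases hk : k = i
  · subst hk; simp [liftSeq]
  · simp [liftSeq, hk]

theorem eventually_eq_of_toProduct_ch (hch : ∀ i w, toProduct F (ch i w) = w)
    (i j : I) (w) : ∀ᶠ n in F, ch i w n = ch j w n :=
  toProduct_eq.1 ((hch i w).trans (hch j w).symm)

/-- Representatives depend on the coordinate, so a moved coordinate changes its lift on an `F`-null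
set. Finitely many moves still leave agreement almost everywhere. -/
theorem eventually_liftSeq_comp (hch : ∀ i w, toProduct F (ch i w) = w)
    (s : I → (F : Filter ℕ).Product fun n => I × Z n) {τ : I → I} (hτ : {k | τ k ≠ k}.Finite) :
    ∀ᶠ n in F, liftSeq ch (s ∘ τ) n = liftSeq ch s n ∘ τ := by
  have : ∀ᶠ n in F, ∀ k ∈ {k | τ k ≠ k}, ch k (s (τ k)) n = ch (τ k) (s (τ k)) n :=
    (Filter.eventually_all_finite hτ).2 fun k _ => eventually_eq_of_toProduct_ch hch _ _ _
  filter_upwards [this] with n hn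
  ext k : 1
  by_cases hk : τ k = k
  · simp [liftSeq, hk]
  · exact hn k hk

open scoped Classical in
/-- In the ultraproduct, lines through split sequences contain all colours. -/
theorem exists_eventually_sameType_update [CommGroup ((F : Filter ℕ).Product C)]
    (hch : ∀ i w, toProduct F (ch i w) = w)
    {h : (F : Filter ℕ).Product Z → (F : Filter ℕ).Product C}
    (hh : ∀ c q, ∃ z, z ≠ q ∧ h z = c)
    {f : (I → (F : Filter ℕ).Product fun n => I × Z n) → (F : Filter ℕ).Product C}
    (hf : ∀ s i y, f (Function.update s i y) * h (productMap F (fun _ w => w.2) (s i)) =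
      f s * h (productMap F (fun _ w => w.2) y))
    {s : I → (F : Filter ℕ).Product fun n => I × Z n} (hs : ∀ᶠ n in F, IsSplit (liftSeq ch s n))
    (i : I) (d : (F : Filter ℕ).Product C) :
    ∃ y, (∀ᶠ n in F, SameType (liftSeq ch (Function.update s i y) n) (liftSeq ch s n)) ∧
      f (Function.update s i y) = d := by
  have hq : ∀ n, ∃ q, IsSplit (liftSeq ch s n) → ∀ z, z ≠ q →
      SameType (Function.update (liftSeq ch s n) i ((liftSeq ch s n i).1, z))
        (liftSeq ch s n) := by
    intro n
    by_cases hn : IsSplit (liftSeq ch s n)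
    · obtain ⟨q, hq⟩ := hn.exists_forbidden i
      exact ⟨q, fun _ => hq⟩
    · exact ⟨(liftSeq ch s n i).2, fun h => absurd h hn⟩
  choose q hq using hq
  -- The value of `h` that turns colour `f s` into `d`, attained away from the forbidden value.
  obtain ⟨z', hzq, hz⟩ := hh (d * h (productMap F (fun _ w => w.2) (s i)) / f s) (toProduct F q)
  obtain ⟨z, rfl⟩ := exists_toProduct z'
  let y : (F : Filter ℕ).Product fun n => I × Z n :=
    toProduct F fun n => ((liftSeq ch s n i).1, z n)
  refine ⟨y, ?_, ?_⟩
  · have h1 : ∀ᶠ n in F, ch i y n = ((liftSeq ch s n i).1, z n) := toProduct_eq.1 (hch i y)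
    have h2 : ∀ᶠ n in F, z n ≠ q n :=
      Ultrafilter.eventually_not.2 fun h => hzq (toProduct_eq.2 h)
    filter_upwards [h1, h2, hs] with n h1 h2 hs
    rw [liftSeq_update, h1]
    exact hq n hs _ h2
  · have h1 := hf s i y
    have h2 : h (productMap F (fun _ w => w.2) y) =
        d * h (productMap F (fun _ w => w.2) (s i)) / f s := hz
    rw [h2, mul_div_cancel] at h1
    exact mul_right_cancel h1

variable [∀ n, Finite (Z n)]

/-- The interpretation of an element of the ultraproduct as a set of sequences. -/
def ultraRep (ch : I → (F : Filter ℕ).Product (fun n => I × Z n) → ∀ n, I × Z n)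
    (col : (I → (F : Filter ℕ).Product fun n => I × Z n) → ∀ n, C n)
    (x : (ultraproduct F fun n => colorAlg I (Z n) (C n)).carrier) :
    Set (I → (F : Filter ℕ).Product fun n => I × Z n) :=
  Quotient.lift (s := Filter.productSetoid (F : Filter ℕ) _)
    (fun (X : ∀ n, (colorAlg I (Z n) (C n)).carrier) =>
      {s | ∀ᶠ n in F, (liftSeq ch s n, col s n) ∈ (X n).1}) (fun X Y h => by
        ext s
        refine Filter.eventually_congr ?_
        filter_upwards [h] with n hn
        rw [hn]) x

/-- The argument is that of Łoś, with the colour of a sequence supplied by `col`. The product rule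
`hf` gives both needed properties: invariance under transpositions, and all colours on every line
through a split sequence. The condition `hcol` upgrades equality of colour classes to equality of
representatives. -/
theorem isFullRep_ultraRep (hch : ∀ i w, toProduct F (ch i w) = w)
    [CommGroup ((F : Filter ℕ).Product C)]
    {h : (F : Filter ℕ).Product Z → (F : Filter ℕ).Product C}
    (hh : ∀ c q, ∃ z, z ≠ q ∧ h z = c)
    {col : (I → (F : Filter ℕ).Product fun n => I × Z n) → ∀ n, C n}
    (hcol : ∀ s t, toProduct F (col s) = toProduct F (col t) → col s = col t)
    (hf : ∀ s i y, toProduct F (col (open Classical in Function.update s i y)) *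
      h (productMap F (fun _ w => w.2) (s i)) =
        toProduct F (col s) * h (productMap F (fun _ w => w.2) y)) :
    (ultraproduct F fun n => colorAlg I (Z n) (C n)).IsFullRep _ (ultraRep ch col) := by
  classical
  have hswap : ∀ s (i j : I), col (s ∘ Equiv.swap i j) = col s := fun s i j =>
    hcol _ _ (apply_comp_swap_of_update (Φ := fun s => toProduct F (col s))
      (g := fun w => h (productMap F (fun _ w => w.2) w))
      (fun s i y => by convert hf s i y) s i j)
  refine ⟨⟨?_, ?_, ?_, ?_, ?_, ?_, ?_⟩, ?_, ?_⟩
  · rintro ⟨X⟩ ⟨Y⟩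
    ext s
    exact Ultrafilter.eventually_or
  · rintro ⟨X⟩ ⟨Y⟩
    ext s
    exact Filter.eventually_and
  · rintro ⟨X⟩
    ext s
    exact Ultrafilter.eventually_not
  · ext s
    exact Filter.eventually_false_iff_eq_bot.trans (iff_false_intro F.neBot.ne)
  · ext s
    exact iff_true_intro (Filter.Eventually.of_forall fun _ => trivial)
  · rintro i ⟨X⟩ s
    change (∀ᶠ n in F, ∃ y d, (Function.update (liftSeq ch s n) i y, d) ∈ (X n).1) ↔
      ∃ y, ∀ᶠ n in F,
        (liftSeq ch (Function.update s i y) n, col (Function.update s i y) n) ∈ (X n).1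
    constructor
    · intro hs
      have hsk : ∀ n, ∃ (y : I × Z n) (d : C n),
          (∃ y d, (Function.update (liftSeq ch s n) i y, d) ∈ (X n).1) →
            (Function.update (liftSeq ch s n) i y, d) ∈ (X n).1 := by
        intro n
        by_cases hn : ∃ y d, (Function.update (liftSeq ch s n) i y, d) ∈ (X n).1
        · obtain ⟨y, d, hyd⟩ := hn
          exact ⟨y, d, fun _ => hyd⟩
        · exact ⟨liftSeq ch s n i, col s n, fun h => absurd h hn⟩
      choose y d hyd using hsk
      have h1 : ∀ᶠ n in F,
          (liftSeq ch (Function.update s i (toProduct F y)) n, d n) ∈ (X n).1 := by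
        filter_upwards [hs, toProduct_eq.1 (hch i (toProduct F y))] with n hn hy
        rw [liftSeq_update, hy]
        exact hyd n hn
      -- Almost everywhere split: adjust `y` to reach the colour `d`. Almost nowhere split: the
      -- colour is irrelevant.
      rcases F.em fun n => IsSplit (liftSeq ch (Function.update s i (toProduct F y)) n)
        with hsp | hsp
      · obtain ⟨y', h2, h3⟩ := exists_eventually_sameType_update hch hh
          (f := fun s => toProduct F (col s)) (fun s i y => by convert hf s i y) hsp i
          (toProduct F d)
        simp only [Function.update_idem] at h2 h3
        refine ⟨y', ?_⟩
        filter_upwards [h1, h2, toProduct_eq.1 h3] with n h1 h2 h3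
        exact (X n).2 _ _ _ _ h2.symm (fun _ => h3.symm) h1
      · refine ⟨toProduct F y, ?_⟩
        filter_upwards [h1, hsp] with n h1 hsp
        exact (X n).2 _ _ _ _ (SameType.refl _) (fun h => absurd h hsp) h1
    · rintro ⟨y, hy⟩
      filter_upwards [hy] with n hn
      rw [liftSeq_update] at hn
      exact ⟨_, _, hn⟩
  · intro i j s
    change (∀ᶠ n in F, ch i (s i) n = ch j (s j) n) ↔ _
    rw [← toProduct_eq, hch, hch]
  · rintro i j ⟨X⟩ s
    change (∀ᶠ n in F, (liftSeq ch s n ∘ Function.update id i j, col s n) ∈ (X n).1) ↔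
      ∀ᶠ n in F, (liftSeq ch (s ∘ Function.update id i j) n,
        col (s ∘ Function.update id i j) n) ∈ (X n).1
    by_cases hij : i = j
    · subst hij
      rw [show Function.update id i i = (id : I → I) from Function.update_eq_self i id]
      rfl
    refine Filter.eventually_congr ?_
    have hfin : {k | Function.update id i j k ≠ k}.Finite :=
      (Set.finite_singleton i).subset fun k hk => by
        by_contra hki
        exact hk (Function.update_of_ne hki _ _)
    filter_upwards [eventually_liftSeq_comp hch s hfin] with n hn
    rw [hn]
    have hns : ¬ IsSplit (liftSeq ch s n ∘ Function.update id i j) := not_isSplit_comp_update hij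
    exact ⟨(X n).2 _ _ _ _ (SameType.refl _) (fun h => absurd h hns),
      (X n).2 _ _ _ _ (SameType.refl _) (fun h => absurd h hns)⟩
  · rintro i j ⟨X⟩ s
    change (∀ᶠ n in F, (liftSeq ch s n ∘ Equiv.swap i j, col s n) ∈ (X n).1) ↔
      ∀ᶠ n in F, (liftSeq ch (s ∘ Equiv.swap i j) n, col (s ∘ Equiv.swap i j) n) ∈ (X n).1
    refine Filter.eventually_congr ?_
    have hfin : {k | Equiv.swap i j k ≠ k}.Finite :=
      ((Set.finite_singleton i).union (Set.finite_singleton j)).subset fun k hk => by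
        by_contra hki
        simp only [Set.mem_union, Set.mem_singleton_iff, not_or] at hki
        exact hk (Equiv.swap_apply_of_ne_of_ne hki.1 hki.2)
    filter_upwards [eventually_liftSeq_comp hch s hfin] with n hn
    rw [hn, hswap]

/-- If a map from points to colours in the ultraproduct has fibres of at least two elements, the
ultraproduct of the colour algebras is representable. -/
theorem isRQEA_ultraproduct_colorAlg [Nontrivial I] [∀ n, Nonempty (Z n)] [∀ n, Nonempty (C n)]
    [CommGroup ((F : Filter ℕ).Product C)]
    {h : (F : Filter ℕ).Product Z → (F : Filter ℕ).Product C}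
    (hh : ∀ c q, ∃ z, z ≠ q ∧ h z = c) :
    IsRQEA (ultraproduct F fun n => colorAlg I (Z n) (C n)) := by
  classical
  refine isRQEA_of_separating fun x y hxy => ?_
  obtain ⟨X, rfl⟩ := exists_toProduct (F := F) x
  obtain ⟨Y, rfl⟩ := exists_toProduct (F := F) y
  have hXY : ∀ᶠ n in F, X n ≠ Y n :=
    Ultrafilter.eventually_not.2 fun h => hxy (toProduct_eq.2 h)
  have hp : ∀ n, ∃ p : (I → I × Z n) × C n, X n ≠ Y n → (p ∈ (X n).1 ↔ p ∉ (Y n).1) := by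
    intro n
    by_cases hn : X n = Y n
    · exact ⟨Classical.arbitrary _, fun h => absurd hn h⟩
    · by_contra! hc
      refine hn (colorAlg.ext fun s c => ?_)
      have := (hc (s, c)).2
      tauto
  choose p hp using hp
  -- A separate section for each coordinate makes `s₀` lift to `(p n).1` exactly; agreement almost
  -- everywhere would not be uniform over infinitely many coordinates.
  choose ch hch hchp using fun i => exists_section_toProduct (F := F) fun n => (p n).1 i
  obtain ⟨ρ, hρ, hρp⟩ := exists_section_toProduct (F := F) fun n => (p n).2
  let s₀ : I → (F : Filter ℕ).Product fun n => I × Z n := fun i =>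
    toProduct F fun n => (p n).1 i
  obtain ⟨Φ, hΦ⟩ := exists_tailProd (I := I)
    (fun w : (F : Filter ℕ).Product fun n => I × Z n => h (productMap F (fun _ w => w.2) w))
  -- A constant factor preserves the product rule and gives `s₀` the colour of the separating points
  -- `p n`.
  let f := fun s => Φ s * ((Φ s₀)⁻¹ * toProduct F fun n => (p n).2)
  have hf₀ : f s₀ = toProduct F fun n => (p n).2 := mul_inv_cancel_left _ _
  have hlift : ∀ n, liftSeq ch s₀ n = (p n).1 := fun n => funext fun i => congrFun (hchp i) n
  have hcol₀ : ρ (f s₀) = fun n => (p n).2 := by rw [hf₀, hρp]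
  refine ⟨_, ultraRep ch fun s => ρ (f s), isFullRep_ultraRep hch hh (fun s t hst => ?_)
    (fun s i y => ?_), fun hc => ?_⟩
  · rw [hρ, hρ] at hst
    rw [hst]
  · rw [hρ, hρ]
    simp only [f]
    rw [mul_right_comm, hΦ, mul_right_comm]
  · have h1 : (∀ᶠ n in F, p n ∈ (X n).1) ↔ ∀ᶠ n in F, p n ∈ (Y n).1 := by
      have := Set.ext_iff.1 hc s₀
      change (∀ᶠ n in F, (liftSeq ch s₀ n, ρ (f s₀) n) ∈ (X n).1) ↔
        ∀ᶠ n in F, (liftSeq ch s₀ n, ρ (f s₀) n) ∈ (Y n).1 at this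
      simpa only [hlift, hcol₀] using this
    have h2 : (∀ᶠ n in F, p n ∈ (X n).1) ↔ ∀ᶠ n in F, p n ∉ (Y n).1 :=
      Filter.eventually_congr (hXY.mono fun n hn => hp n hn)
    rw [Ultrafilter.eventually_not] at h2
    tauto

end Ultraproduct

/-! ### Equations and finite schemata in ultraproducts. -/

/-- Representable algebras satisfy the axioms of quasi-polyadic equality algebras. -/
theorem IsRQEA.isQEA {I : Type u} [Nontrivial I] {A : QPEAlg I} (h : IsRQEA A) : IsQEA A := by
  classical
  have key : ∀ x y : A.carrier, (∀ (U : Type u) (Φ : A.carrier → Set (I → U)),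
      A.IsFullRep U Φ → ∀ s, s ∈ Φ x ↔ s ∈ Φ y) → x = y := by
    intro x y hxy
    by_contra hne
    obtain ⟨U, Φ, hΦ, hne'⟩ := h.exists_isFullRep hne
    exact hne' (Set.ext (hxy U Φ hΦ))
  have upd : ∀ i : I, (Function.update id i i : I → I) = id := fun i =>
    Function.update_eq_self i id
  have hbool : A.toCylAlg.IsBoolean := by
    obtain ⟨S, V, -, f, hf, hh⟩ := h
    exact CylAlg.isBoolean_of_injective (Q := V) f hf hh.toCyl.map_add hh.toCyl.map_mul
      hh.toCyl.map_compl hh.toCyl.map_zero hh.toCyl.map_one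
  refine ⟨hbool, ?_, ?_, ?_, ?_, ?_, ?_, ?_, ?_, ?_, ?_, ?_, ?_, ?_, ?_, ?_⟩
  · intro i x
    refine key _ _ fun U Φ hΦ s => ?_
    rw [hΦ.mem_repl, upd, Function.comp_id]
  · intro i x
    refine key _ _ fun U Φ hΦ s => ?_
    rw [hΦ.mem_swap, Equiv.swap_self]
    rfl
  · intro i j x
    refine key _ _ fun U Φ hΦ s => ?_
    rw [hΦ.mem_swap, hΦ.mem_swap, Equiv.swap_comm]
  · intro i x
    refine key _ _ fun U Φ hΦ s => ?_
    rw [hΦ.toCyl.map_add, Set.mem_union, hΦ.toCyl.mem_cyl]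
    refine or_iff_right_of_imp fun h => ⟨s i, ?_⟩
    rwa [Function.update_eq_self]
  · intro i x y
    refine key _ _ fun U Φ hΦ s => ?_
    simp only [hΦ.toCyl.map_add, Set.mem_union, hΦ.toCyl.mem_cyl, exists_or]
  · intro i j x
    refine key _ _ fun U Φ hΦ s => ?_
    simp only [hΦ.toCyl.mem_cyl, hΦ.mem_repl]
    refine exists_congr fun y => ?_
    convert Iff.rfl using 2
    ext k : 1
    by_cases hk : k = i <;> simp [hk]
  · intro i j x hij
    refine key _ _ fun U Φ hΦ s => ?_
    have e : ∀ y, Function.update s i y ∘ Function.update id i j = s ∘ Function.update id i j := by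
      intro y
      ext k : 1
      by_cases hk : k = i
      · subst hk; simp [hij.symm]
      · simp [hk]
    simp only [hΦ.toCyl.mem_cyl, hΦ.mem_repl, e]
    exact ⟨fun ⟨_, h⟩ => h, fun h => ⟨s i, h⟩⟩
  · intro i j k x hki hkj
    refine key _ _ fun U Φ hΦ s => ?_
    simp only [hΦ.toCyl.mem_cyl, hΦ.mem_repl]
    refine exists_congr fun y => ?_
    convert Iff.rfl using 2
    ext l : 1
    by_cases hl : l = i
    · subst hl; simp [hki.symm, hkj.symm]
    · by_cases hl' : l = k <;> simp [hl, hl', hki]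
  · intro i j
    refine ⟨fun x y => ?_, fun x y => ?_, fun x => ?_, ?_, ?_⟩ <;>
      refine key _ _ fun U Φ hΦ s => ?_ <;>
      simp [hΦ.mem_repl, hΦ.toCyl.map_add, hΦ.toCyl.map_mul, hΦ.toCyl.map_compl,
        hΦ.toCyl.map_zero, hΦ.toCyl.map_one]
  · intro i j
    refine ⟨fun x y => ?_, fun x y => ?_, fun x => ?_, ?_, ?_⟩ <;>
      refine key _ _ fun U Φ hΦ s => ?_ <;>
      simp [hΦ.mem_swap, hΦ.toCyl.map_add, hΦ.toCyl.map_mul, hΦ.toCyl.map_compl,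
        hΦ.toCyl.map_zero, hΦ.toCyl.map_one]
  · intro i j x
    refine key _ _ fun U Φ hΦ s => ?_
    rw [hΦ.mem_swap, hΦ.mem_swap, Function.comp_assoc, ← Equiv.Perm.coe_mul,
      Equiv.swap_mul_self]
    rfl
  · intro i j k x hij hik hjk
    refine key _ _ fun U Φ hΦ s => ?_
    simp only [hΦ.mem_swap, Function.comp_assoc, ← Equiv.Perm.coe_mul]
    congr! 3
    ext l : 1
    simp only [Equiv.Perm.mul_apply, Equiv.swap_apply_def]
    split_ifs <;> simp_all
  · intro i j x
    refine key _ _ fun U Φ hΦ s => ?_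
    simp only [hΦ.mem_swap, hΦ.mem_repl, Function.comp_assoc]
    congr! 3
    ext l : 1
    by_cases hli : l = i <;> by_cases hlj : l = j <;> by_cases hij : i = j <;>
      simp_all [Equiv.swap_apply_def]
  · intro i j
    refine key _ _ fun U Φ hΦ s => ?_
    simp only [hΦ.mem_repl, hΦ.toCyl.mem_diag, hΦ.toCyl.map_one, Set.mem_univ, iff_true]
    by_cases hij : j = i <;> simp [hij]
  · intro i j x
    refine key _ _ fun U Φ hΦ s => ?_
    rw [hΦ.toCyl.map_add, hΦ.toCyl.map_mul, Set.mem_union, Set.mem_inter_iff, hΦ.toCyl.mem_diag,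
      hΦ.mem_repl]
    refine or_iff_right_of_imp fun h => ?_
    convert h.1 using 1
    ext k : 1
    by_cases hk : k = i
    · subst hk; simp [h.2]
    · simp [hk]

/-- Terms are evaluated in an ultraproduct factor by factor. -/
theorem QTerm.eval_ultraproduct {I : Type u} (F : Ultrafilter ℕ) (B : ℕ → QPEAlg I)
    (a : ∀ n, ℕ → (B n).carrier) (t : QTerm I) :
    t.eval (ultraproduct F B) (fun k => toProduct F fun n => a n k) =
      toProduct F fun n => t.eval (B n) (a n) := by
  induction t with
  | var n => rfl
  | zero => rfl
  | one => rfl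
  | add s t hs ht => exact congrArg₂ (ultraproduct F B).add hs ht
  | mul s t hs ht => exact congrArg₂ (ultraproduct F B).mul hs ht
  | compl t ht => exact congrArg (ultraproduct F B).compl ht
  | cyl i t ht => exact congrArg ((ultraproduct F B).cyl i) ht
  | diag i j => rfl
  | repl i j t ht => exact congrArg ((ultraproduct F B).repl i j) ht
  | swap i j t ht => exact congrArg ((ultraproduct F B).swap i j) ht

theorem QTerm.exists_reindex_congr {J : Type*} (t : QTerm ℕ) :
    ∃ N : ℕ, ∀ η η' : ℕ → J, (∀ k < N, η k = η' k) → t.reindex η = t.reindex η' := by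
  induction t with
  | var n => exact ⟨0, fun _ _ _ => rfl⟩
  | zero => exact ⟨0, fun _ _ _ => rfl⟩
  | one => exact ⟨0, fun _ _ _ => rfl⟩
  | add s t hs ht =>
    obtain ⟨N, hN⟩ := hs
    obtain ⟨M, hM⟩ := ht
    refine ⟨max N M, fun η η' h => congrArg₂ QTerm.add (hN _ _ fun k hk => h k ?_)
      (hM _ _ fun k hk => h k ?_)⟩ <;> omega
  | mul s t hs ht =>
    obtain ⟨N, hN⟩ := hs
    obtain ⟨M, hM⟩ := ht
    refine ⟨max N M, fun η η' h => congrArg₂ QTerm.mul (hN _ _ fun k hk => h k ?_)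
      (hM _ _ fun k hk => h k ?_)⟩ <;> omega
  | compl t ht =>
    obtain ⟨N, hN⟩ := ht
    exact ⟨N, fun η η' h => congrArg QTerm.compl (hN _ _ h)⟩
  | cyl i t ht =>
    obtain ⟨N, hN⟩ := ht
    refine ⟨max N (i + 1), fun η η' h => congrArg₂ QTerm.cyl (h i ?_)
      (hN _ _ fun k hk => h k ?_)⟩ <;> omega
  | diag i j =>
    refine ⟨max i j + 1, fun η η' h => congrArg₂ QTerm.diag (h i ?_) (h j ?_)⟩ <;> omega
  | repl i j t ht =>
    obtain ⟨N, hN⟩ := ht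
    refine ⟨max N (max i j + 1), fun η η' h => ?_⟩
    simp only [QTerm.reindex]
    rw [h i (by omega), h j (by omega), hN η η' fun k hk => h k (by omega)]
  | swap i j t ht =>
    obtain ⟨N, hN⟩ := ht
    refine ⟨max N (max i j + 1), fun η η' h => ?_⟩
    simp only [QTerm.reindex]
    rw [h i (by omega), h j (by omega), hN η η' fun k hk => h k (by omega)]

/-- The symmetric group is `N`-transitive. Finite agreement suffices, since a term mentions finitely
many dimensions. -/
theorem exists_perm_extending {J : Type*} {η η' : ℕ → J} (hη : Function.Injective η)
    (hη' : Function.Injective η') (N : ℕ) : ∃ π : Equiv.Perm J, ∀ k < N, π (η k) = η' k := by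
  have := Equiv.Perm.isMultiplyPretransitive J N
  obtain ⟨π, hπ⟩ := MulAction.exists_smul_eq (Equiv.Perm J)
    (⟨fun k => η k, hη.comp Fin.val_injective⟩ : Fin N ↪ J)
    ⟨fun k => η' k, hη'.comp Fin.val_injective⟩
  refine ⟨π, fun k hk => ?_⟩
  exact DFunLike.congr_fun hπ (⟨k, hk⟩ : Fin N)

/-- A finite schema that fails in all members of a sequence of colour algebras fails in their
ultraproducts. -/
theorem colorAlg.not_satisfiesSchema_ultraproduct {I : Type u} [Infinite I] {Z C : ℕ → Type}
    [∀ n, Finite (Z n)] {E : Set (QTerm ℕ × QTerm ℕ)} (hE : E.Finite)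
    (h : ∀ n, ¬ SatisfiesSchema (colorAlg I (Z n) (C n)) E) (F : Ultrafilter ℕ) :
    ¬ SatisfiesSchema (ultraproduct F fun n => colorAlg I (Z n) (C n)) E := by
  intro hsat
  unfold SatisfiesSchema at h
  push Not at h
  choose e he η hη a ha using h
  -- Finiteness of `E` is used here: one equation fails in almost all factors.
  obtain ⟨e₀, he₀, hev⟩ : ∃ e₀ ∈ E, ∀ᶠ n in F, e n = e₀ := by
    have h1 : ⋃ e₀ ∈ E, {n | e n = e₀} ∈ F := by
      have : ⋃ e₀ ∈ E, {n | e n = e₀} = Set.univ :=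
        Set.eq_univ_of_forall fun n => Set.mem_biUnion (he n) rfl
      rw [this]
      exact Filter.univ_mem
    exact (Ultrafilter.finite_biUnion_mem_iff hE).1 h1
  let η₀ : ℕ → I := Infinite.natEmbedding I
  have hη₀ : Function.Injective η₀ := (Infinite.natEmbedding I).injective
  obtain ⟨N₁, hN₁⟩ := e₀.1.exists_reindex_congr (J := I)
  obtain ⟨N₂, hN₂⟩ := e₀.2.exists_reindex_congr (J := I)
  -- The failing instances `η n` vary with `n`; permuting dimensions moves them all to `η₀`.
  choose π hπ using fun n => exists_perm_extending (hη n) hη₀ (max N₁ N₂)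
  have h2 := hsat e₀ he₀ η₀ hη₀ fun k => toProduct F fun n => colorAlg.perm (π n) (a n k)
  rw [QTerm.eval_ultraproduct F _ fun n k => colorAlg.perm (π n) (a n k),
    QTerm.eval_ultraproduct F _ fun n k => colorAlg.perm (π n) (a n k)] at h2
  obtain ⟨n, hn, hne⟩ := ((toProduct_eq.1 h2).and hev).exists
  rw [hN₁ η₀ (π n ∘ η n) fun k hk => (hπ n k (by omega)).symm,
    hN₂ η₀ (π n ∘ η n) fun k hk => (hπ n k (by omega)).symm, colorAlg.eval_perm,
    colorAlg.eval_perm] at hn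
  rw [← hne] at hn
  exact ha n (colorAlg.perm_injective _ hn)

/-! ### The algebras over prime fields and the conclusion. -/

theorem exists_odd_prime_ge (n : ℕ) : ∃ p, n + 3 ≤ p ∧ p.Prime :=
  Nat.exists_infinite_primes (n + 3)

/-- A sequence of odd primes that tends to infinity. -/
noncomputable def oddPrime (n : ℕ) : ℕ := (exists_odd_prime_ge n).choose

theorem le_oddPrime (n : ℕ) : n + 3 ≤ oddPrime n := (exists_odd_prime_ge n).choose_spec.1

instance fact_prime_oddPrime (n : ℕ) : Fact (oddPrime n).Prime :=
  ⟨(exists_odd_prime_ge n).choose_spec.2⟩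

theorem infinite_product_units {F : Ultrafilter ℕ} (hF : (F : Filter ℕ) ≤ Filter.cofinite) :
    Infinite ((F : Filter ℕ).Product fun n => (ZMod (oddPrime n))ˣ) := by
  refine Infinite.of_injective
    (fun j : ℕ => toProduct F fun n => unitOrOne ((j + 1 : ℕ) : ZMod (oddPrime n)))
    fun j j' hj => ?_
  -- Then `j + 1` and `j' + 1` lie below `oddPrime n`, hence are nonzero residues, and distinct
  -- unless `j = j'`.
  have h1 : ∀ᶠ n in F, j + j' ≤ n := by
    rw [Nat.cofinite_eq_atTop] at hF
    exact hF (Filter.eventually_ge_atTop _)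
  obtain ⟨n, h2, h1⟩ := ((toProduct_eq.1 hj).and h1).exists
  have hn := le_oddPrime n
  have hne : ∀ m : ℕ, m ≤ n → ((m + 1 : ℕ) : ZMod (oddPrime n)) ≠ 0 := by
    intro m hm h
    rw [ZMod.natCast_eq_zero_iff] at h
    have := Nat.le_of_dvd (by omega) h
    omega
  have h3 := congrArg Units.val h2
  rw [unitOrOne, unitOrOne, dif_neg (hne j (by omega)), dif_neg (hne j' (by omega))] at h3
  change ((j + 1 : ℕ) : ZMod (oddPrime n)) = ((j' + 1 : ℕ) : ZMod (oddPrime n)) at h3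
  rw [ZMod.natCast_eq_natCast_iff', Nat.mod_eq_of_lt (by omega), Nat.mod_eq_of_lt (by omega)] at h3
  omega

/-- As `Y` is infinite, `Y × Bool` embeds into `X`; a left inverse followed by the first projection
has two preimages of every value, one of which avoids `q`. -/
theorem exists_map_two_preimages {X Y : Type} [Infinite Y] {g : Y → X}
    (hg : Function.Injective g) : ∃ h : X → Y, ∀ c q, ∃ z, z ≠ q ∧ h z = c := by
  classical
  have hcard : Cardinal.mk (Y × Bool) = Cardinal.mk Y := by
    rw [Cardinal.mk_prod, Cardinal.lift_id, Cardinal.lift_id]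
    exact Cardinal.mul_eq_left (Cardinal.aleph0_le_mk Y)
      ((Cardinal.lt_aleph0_of_finite Bool).le.trans (Cardinal.aleph0_le_mk Y)) (by simp)
  obtain ⟨e⟩ := Cardinal.eq.1 hcard
  have hinj : Function.Injective (g ∘ e) := hg.comp e.injective
  refine ⟨fun x => (Function.invFun (g ∘ e) x).1, fun c q => ?_⟩
  have hinv : ∀ b, (Function.invFun (g ∘ e) ((g ∘ e) (c, b))).1 = c := fun b => by
    rw [Function.leftInverse_invFun hinj]
  by_cases hq : (g ∘ e) (c, true) = q
  · refine ⟨(g ∘ e) (c, false), fun h => ?_, hinv _⟩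
    have := hinj (hq.trans h.symm)
    simp at this
  · exact ⟨_, hq, hinv _⟩

/-- The colour algebra with an odd prime number of points of each label. -/
noncomputable def primeColorAlg (I : Type u) (n : ℕ) : QPEAlg I :=
  colorAlg I (ZMod (oddPrime n)) (ZMod (oddPrime n))ˣ

theorem not_isRQEA_primeColorAlg (I : Type u) [Infinite I] (n : ℕ) :
    ¬ IsRQEA (primeColorAlg I n) := by
  have h3 := le_oddPrime n
  refine colorAlg.not_isRQEA I _ _ ?_ ?_
  · rw [ZMod.card_units, ZMod.card]
    omega
  · rw [ZMod.card]
    exact (fact_prime_oddPrime n).out.odd_of_ne_two (by omega)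

theorem isRCA_primeColorAlg (I : Type u) [Nontrivial I] (n : ℕ) :
    IsRCA (primeColorAlg I n).toCylAlg := by
  obtain ⟨f, hf⟩ := exists_isFullColoring I (ZMod (oddPrime n))
  exact colorAlg.isRCA_of_isFullColoring hf

theorem isRQEA_ultraproduct_primeColorAlg (I : Type u) [Nontrivial I] {F : Ultrafilter ℕ}
    (hF : (F : Filter ℕ) ≤ Filter.cofinite) : IsRQEA (ultraproduct F (primeColorAlg I)) := by
  have := infinite_product_units hF
  -- Any commutative group structure on the colours will do; here it is the additive group of an
  -- arbitrary field structure.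
  obtain ⟨K⟩ := Infinite.nonempty_field (α := (F : Filter ℕ).Product fun n => (ZMod (oddPrime n))ˣ)
  let _ : CommGroup ((F : Filter ℕ).Product fun n => (ZMod (oddPrime n))ˣ) :=
    Multiplicative.commGroup (α := (F : Filter ℕ).Product fun n => (ZMod (oddPrime n))ˣ)
  have hinj : Function.Injective
      (productMap F fun n (c : (ZMod (oddPrime n))ˣ) => (c : ZMod (oddPrime n))) := by
    intro x y hxy
    obtain ⟨x, rfl⟩ := exists_toProduct x
    obtain ⟨y, rfl⟩ := exists_toProduct y
    refine toProduct_eq.2 ?_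
    filter_upwards [toProduct_eq.1 hxy] with n hn
    exact Units.ext hn
  obtain ⟨h, hh⟩ := exists_map_two_preimages hinj
  exact isRQEA_ultraproduct_colorAlg hh

theorem mainTheorem4 (α : Ordinal.{u}) (hα : Ordinal.omega0 ≤ α) :
    (¬ ∃ E : Set (QTerm ℕ × QTerm ℕ), E.Finite ∧
      ∀ A : QPEAlg.{u} α.ToType, IsQEA A →
        (IsRQEA A ↔ IsRCA A.toCylAlg ∧ SatisfiesSchema A E)) ∧
    ∃ B : ℕ → QPEAlg.{u} α.ToType,
      (∀ n, IsQEA (B n) ∧ ¬ IsRQEA (B n) ∧ IsRCA (B n).toCylAlg) ∧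
      ∀ F : Ultrafilter ℕ, (F : Filter ℕ) ≤ Filter.cofinite → IsRQEA (ultraproduct F B) := by
  have : Infinite α.ToType := by
    rw [Cardinal.infinite_iff, Cardinal.mk_toType]
    exact Ordinal.aleph0_le_card.2 hα
  refine ⟨?_, primeColorAlg α.ToType, fun n => ⟨colorAlg.isQEA, not_isRQEA_primeColorAlg _ n,
    isRCA_primeColorAlg _ n⟩, fun F hF => isRQEA_ultraproduct_primeColorAlg _ hF⟩
  rintro ⟨E, hE, h⟩
  have hrep := isRQEA_ultraproduct_primeColorAlg α.ToType (F := Filter.hyperfilter ℕ)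
    (Filter.hyperfilter_le_cofinite)
  -- The ultraproduct is representable, so it satisfies `E`; each factor has a representable
  -- cylindric reduct without being representable, so it violates `E`.
  refine colorAlg.not_satisfiesSchema_ultraproduct hE (fun n hn => ?_) (Filter.hyperfilter ℕ)
    ((h _ hrep.isQEA).1 hrep).2
  exact not_isRQEA_primeColorAlg _ n ((h _ colorAlg.isQEA).2 ⟨isRCA_primeColorAlg _ n, hn⟩)
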